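/- Let $f_i(x)=r_ix+c_i$ $(1\le i\le m)$, $0<|r_i|<1$, be contractive similitudes of $\mathbb R$, let $K$ be their attractor, i.e. the non-empty compact set with $K=\bigcup_i f_i(K)$, assume that $K$ has more than one point, and put $I=\operatorname{conv}(K)$, $T_i=f_i^{-1}$. For a coding $(i_n)$ of $x\in K$ (that is, $x=\lim_n f_{i_1}\circ\cdots\circ f_{i_n}(0)$) call $\{T_{i_n}\circ\cdots\circ T_{i_1}(x):n\ge 0\}$ an orbit of $x$. Assume: (a) the system is exactly overlapping: whenever $i\ne j$ and $f_i(K)\cap f_j(K)\neq\emptyset$, this intersection is a finite union of sets each of which has both the form $f_i\circ f_{i_2}\circ\cdots\circ f_{i_k}(K)$ and the form $f_j\circ f_{j_2}\circ\cdots\circ f_{j_r}(K)$; (b) every endpoint of every $f_j(K)$ (its minimum and its maximum) is periodic: the cardinalities of all its orbits are bounded by a common constant; (c) the lazy algorithm is well defined: let $a<a'$ be neighbouring points of the set of all endpoints of the $f_j(K)$ such that $(a,a')\cap K\ne\emptyset$ and $a,a'\in f_k(I)$ for some $k$. If $\alpha$ is the smallest such $k$, then $[a,a']\cap K$ is contained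 in the domain $f_\alpha(K)$ of $T_\alpha$. Then the set $P$ of all points on orbits of endpoints of the $f_j(K)$ is finite. Let $V$ be the set of pairs $u=(b_u,b_u')$ of neighbouring points $b_u<b_u'$ of $P$ with $(b_u,b_u')\cap K\neq\emptyset$, let $B_u=[b_u,b_u']\cap K$ (the blocks of the Markov partition), let $\alpha(u)$ be the smallest $k$ with $b_u,b_u'\in f_k(I)$, and let $S_{uv}=1$ if $B_v\subseteq T_{\alpha(u)}(B_u)$ and $S_{uv}=0$ otherwise. Then the following hold. (1) $K=\bigcup_{u\in V}B_u$. (2) The directed graph of $S$, with the intervals $[b_u,b_u']$ and the similitude $f_{\alpha(u)}$ on each edge $(u,v)$, is a graph-directed construction satisfying the open set condition: the open intervals $O_u=(b_u,b'_u)$ are pairwise disjoint, every vertex has an outgoing edge, and for each $u$ the sets $f_{\alpha(u)}(O_v)$, $S_{uv}=1$, are pairwise disjoint subsets of $O_u$. There is exactly one vector $(C_u)_{u\in V}$ of non-empty compact sets with $C_u=\bigcup_{v:S_{uv}=1}f_{\alpha(u)}(C_v)$ for all $u$; it is given by $C_u=\overline{(b_u,b_u')\cap K}$, and $K=\bigcup_{u}C_u$.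 So $K$ is the graph-directed self-similar set of this construction. (3) For $t\ge0$ let $A^t$ be the matrix with entries $|r_{\alpha(u)}|^t$ if $S_{uv}=1$ and $0$ otherwise, and for $D\subseteq V$ let $\Phi_D(t)$ be the largest nonnegative eigenvalue of the restriction of $A^t$ to $D$. Then $\dim_H K=\max\{t\ge 0:\Phi_D(t)=1 \text{ for some strongly connected component } D\}$. (4) If the graph of $S$ is strongly connected, then $\Phi_V(t)=1$ has exactly one solution $t_0\ge 0$, $\dim_HK=t_0$ and $0<\mathcal H^{t_0}(K)<\infty$. -/

import Mathlib

open Set Filter Topology MeasureTheory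

noncomputable section

/-- An iterated function system of `m` contractive similitudes
`f i x = ratio i * x + trans i` of the real line. -/
structure RealIFS (m : ℕ) where
  ratio : Fin m → ℝ
  trans : Fin m → ℝ
  ratio_ne_zero : ∀ i, ratio i ≠ 0
  abs_ratio_lt_one : ∀ i, |ratio i| < 1

namespace RealIFS

variable {m : ℕ}

/-- The similitude `f i`. -/
def map (F : RealIFS m) (i : Fin m) (x : ℝ) : ℝ := F.ratio i * x + F.trans i

/-- The expanding map `T i`, the inverse of `f i` (extended to the whole line). -/
def expand (F : RealIFS m) (i : Fin m) (x : ℝ) : ℝ := (x - F.trans i) / F.ratio i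

/-- `f i₁ ∘ ⋯ ∘ f iₙ` for a finite word `[i₁, …, iₙ]`. -/
def wordMap (F : RealIFS m) : List (Fin m) → ℝ → ℝ
  | [] => id
  | i :: w => F.map i ∘ F.wordMap w

/-- `K` is the self-similar set of the system: the (unique) non-empty compact set with
`K = ⋃ i, f i (K)`. -/
def IsAttractor (F : RealIFS m) (K : Set ℝ) : Prop :=
  K.Nonempty ∧ IsCompact K ∧ K = ⋃ i, F.map i '' K

/-- The composition `f (ω 0) ∘ ⋯ ∘ f (ω (n-1))`. -/
def prefixMap (F : RealIFS m) (ω : ℕ → Fin m) : ℕ → ℝ → ℝ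
  | 0 => id
  | n + 1 => F.prefixMap ω n ∘ F.map (ω n)

/-- `ω` is a coding of `x`. -/
def IsCoding (F : RealIFS m) (ω : ℕ → Fin m) (x : ℝ) : Prop :=
  Tendsto (fun n => F.prefixMap ω n 0) atTop (𝓝 x)

/-- `T (ω (n-1)) ∘ ⋯ ∘ T (ω 0)` applied to `x`. -/
def orbitPoint (F : RealIFS m) (ω : ℕ → Fin m) (x : ℝ) : ℕ → ℝ
  | 0 => x
  | n + 1 => F.expand (ω n) (F.orbitPoint ω x n)

/-- The orbit set of `x` along the coding `ω`. -/
def orbitSet (F : RealIFS m) (ω : ℕ → Fin m) (x : ℝ) : Set ℝ :=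
  Set.range (F.orbitPoint ω x)

/-- `x` is a periodic point: the cardinalities of all its orbit sets are below a common
bound. -/
def IsPeriodicPt (F : RealIFS m) (x : ℝ) : Prop :=
  ∃ M : ℕ, ∀ ω, F.IsCoding ω x → (F.orbitSet ω x).encard < M

/-- The system is exactly overlapping: whenever `f i (K)` and `f j (K)`, `i ≠ j`, meet, their
intersection is a finite union of sets that are at the same time cylinders `f_{i u}(K)` and
`f_{j v}(K)`. -/
def ExactlyOverlapping (F : RealIFS m) (K : Set ℝ) : Prop :=
  ∀ i j : Fin m, i ≠ j → (F.map i '' K ∩ F.map j '' K).Nonempty →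
    ∃ Q : Finset (List (Fin m) × List (Fin m)),
      (∀ q ∈ Q, F.wordMap (i :: q.1) '' K = F.wordMap (j :: q.2) '' K) ∧
      F.map i '' K ∩ F.map j '' K = ⋃ q ∈ Q, F.wordMap (i :: q.1) '' K

/-- The set of all endpoints (minimal and maximal elements of the convex hull) of the first
level pieces `f j (K)`. -/
def endpoints (F : RealIFS m) (K : Set ℝ) : Set ℝ :=
  {a | ∃ j, IsLeast (convexHull ℝ (F.map j '' K)) a ∨
    IsGreatest (convexHull ℝ (F.map j '' K)) a}

/-- The set of all points lying on some orbit of some first level endpoint. -/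
def endpointOrbits (F : RealIFS m) (K : Set ℝ) : Set ℝ :=
  {y | ∃ a ∈ F.endpoints K, ∃ ω, F.IsCoding ω a ∧ y ∈ F.orbitSet ω a}

/-- `c < d` are neighbours in the set `P`. -/
def _root_.Set.Consecutive (P : Set ℝ) (c d : ℝ) : Prop :=
  c ∈ P ∧ d ∈ P ∧ c < d ∧ Set.Ioo c d ∩ P = ∅

/-- Both `c` and `d` lie in `f k (I)`, where `I` is the convex hull of `K`. -/
def HullContains (F : RealIFS m) (K : Set ℝ) (c d : ℝ) (k : Fin m) : Prop :=
  c ∈ F.map k '' convexHull ℝ K ∧ d ∈ F.map k '' convexHull ℝ K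

open Classical in
/-- The lazy choice for the pair `c, d`: the smallest index `k` such that both points lie in
`f k (I)` (with a dummy value if there is none). -/
def lazyIndex [NeZero m] (F : RealIFS m) (K : Set ℝ) (c d : ℝ) : Fin m :=
  if h : (Finset.univ.filter (F.HullContains K c d)).Nonempty then
    (Finset.univ.filter (F.HullContains K c d)).min' h
  else 0

/-- The lazy algorithm is well defined: for each admissible pair `c < d` of neighbouring first
level endpoints (with points of `K` between them), the domain `f k (K)` of the expanding map
`T k` that the algorithm applies on `[c, d] ∩ K` contains `[c, d] ∩ K`. -/
def LazyWellDefined [NeZero m] (F : RealIFS m) (K : Set ℝ) : Prop :=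
  ∀ c d : ℝ, (F.endpoints K).Consecutive c d → (∃ k, F.HullContains K c d k) →
    (Set.Ioo c d ∩ K).Nonempty →
      Set.Icc c d ∩ K ⊆ F.map (F.lazyIndex K c d) '' K

/-- The index set of the blocks: pairs `(c, d)` of neighbouring points of the endpoint orbits
such that `(c, d)` meets `K`. -/
def markovBlocks (F : RealIFS m) (K : Set ℝ) : Set (ℝ × ℝ) :=
  {p | (F.endpointOrbits K).Consecutive p.1 p.2 ∧ (Set.Ioo p.1 p.2 ∩ K).Nonempty}

end RealIFS

/-- The data of a graph-directed system on the real line: a directed graph with vertex set `V`,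
a closed interval `[lo u, hi u]` for each vertex and a map `x ↦ ratio u v * x + trans u v` for
each edge `(u, v)`. -/
structure GraphSystem (V : Type*) where
  lo : V → ℝ
  hi : V → ℝ
  Adj : V → V → Prop
  ratio : V → V → ℝ
  trans : V → V → ℝ

namespace GraphSystem

variable {V : Type*}

/-- The similitude of the edge `(u, v)`. -/
def map (G : GraphSystem V) (u v : V) (x : ℝ) : ℝ := G.ratio u v * x + G.trans u v

/-- The requirements on a graph-directed construction: intervals with pairwise disjoint
interiors, at least one edge out of each vertex, contracting similitudes on the edges, and the
open set condition for the interiors of the intervals. -/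
structure IsGraphDirectedConstruction (G : GraphSystem V) : Prop where
  finite_vertices : Finite V
  lo_lt_hi : ∀ u, G.lo u < G.hi u
  disjoint_interiors : ∀ u v, u ≠ v →
    Disjoint (Set.Ioo (G.lo u) (G.hi u)) (Set.Ioo (G.lo v) (G.hi v))
  exists_edge : ∀ u, ∃ v, G.Adj u v
  ratio_ne_zero : ∀ u v, G.Adj u v → G.ratio u v ≠ 0
  abs_ratio_lt_one : ∀ u v, G.Adj u v → |G.ratio u v| < 1
  open_set_subset : ∀ u v, G.Adj u v →
    G.map u v '' Set.Ioo (G.lo v) (G.hi v) ⊆ Set.Ioo (G.lo u) (G.hi u)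
  open_set_disjoint : ∀ u v w, G.Adj u v → G.Adj u w → v ≠ w →
    Disjoint (G.map u v '' Set.Ioo (G.lo v) (G.hi v))
      (G.map u w '' Set.Ioo (G.lo w) (G.hi w))

/-- `C` is a vector of non-empty compact sets with `C u = ⋃_{(u, v) ∈ E} f_{u, v} (C v)`. -/
def IsInvariant (G : GraphSystem V) (C : V → Set ℝ) : Prop :=
  ∀ u, (C u).Nonempty ∧ IsCompact (C u) ∧ C u = ⋃ (v : V) (_ : G.Adj u v), G.map u v '' C v

/-- `G` is a graph-directed construction and `K` is its graph-directed self-similar set: there is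
exactly one invariant vector of non-empty compact sets, and `K` is the union of its components. -/
def IsGraphDirectedSet (G : GraphSystem V) (K : Set ℝ) : Prop :=
  G.IsGraphDirectedConstruction ∧ (∃! C : V → Set ℝ, G.IsInvariant C) ∧
    ∀ C : V → Set ℝ, G.IsInvariant C → K = ⋃ u, C u

/-- The subgraph with vertex set `D` is strongly connected. -/
def StronglyConnectedOn (G : GraphSystem V) (D : Set V) : Prop :=
  D.Nonempty ∧ ∀ u ∈ D, ∀ v ∈ D,
    Relation.ReflTransGen (fun x y => x ∈ D ∧ y ∈ D ∧ G.Adj x y) u v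

/-- `D` is the vertex set of a strongly connected component. -/
def IsStrongComponent (G : GraphSystem V) (D : Set V) : Prop :=
  Maximal G.StronglyConnectedOn D

open Classical in
/-- The weighted adjacency matrix with entries `|ratio u v| ^ t` on edges and `0` elsewhere. -/
def weightedMatrix (G : GraphSystem V) (t : ℝ) : Matrix V V ℝ :=
  Matrix.of fun u v => if G.Adj u v then |G.ratio u v| ^ t else 0

end GraphSystem

open Classical in
/-- `ρ` is the largest nonnegative (real) eigenvalue of the matrix `A`. -/
def Matrix.IsLargestEigenvalue {V : Type*} [Fintype V] (A : Matrix V V ℝ) (ρ : ℝ) : Prop :=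
  IsGreatest {x : ℝ | 0 ≤ x ∧ Module.End.HasEigenvalue (Matrix.toLin' A) x} ρ

/-- The number `Φ_D(t)` equals one, where `Φ_D(t)` is the largest nonnegative eigenvalue of the
weighted adjacency matrix restricted to the vertices in `D`. -/
def GraphSystem.PhiEqOne {V : Type*} (G : GraphSystem V) (D : Set V) (t : ℝ) : Prop :=
  ∃ _ : Fintype D,
    ((G.weightedMatrix t).submatrix (Subtype.val : D → V) Subtype.val).IsLargestEigenvalue 1

/-- The graph-directed system of the Markov partition: the vertices are the blocks
`B u = [c, d] ∩ K`, the edge `(u, v)` is present if `B v ⊆ T k (B u)`, where `k` is the lazy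
choice for `u`, and it carries the similitude `f k`. -/
def RealIFS.markovSystem {m : ℕ} [NeZero m] (F : RealIFS m) (K : Set ℝ) :
    GraphSystem (F.markovBlocks K) where
  lo u := u.1.1
  hi u := u.1.2
  Adj u v := Set.Icc v.1.1 v.1.2 ∩ K ⊆
    F.expand (F.lazyIndex K u.1.1 u.1.2) '' (Set.Icc u.1.1 u.1.2 ∩ K)
  ratio u _ := F.ratio (F.lazyIndex K u.1.1 u.1.2)
  trans u _ := F.trans (F.lazyIndex K u.1.1 u.1.2)

end

/-!
The system of blocks is a graph-directed construction, and the dimension is then given by the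
theorem of Mauldin and Williams. Both halves are proved here.

*The Markov partition.* A sequence codes `x` exactly if the orbit of `x` along it stays in `K`
(`RealIFS.IsAttractor.isCoding_iff`), so the orbit points of `x` are the points reachable from `x` by
inverse branches inside `K`. A shortest way to such a point repeats no point, hence a bound for the
cardinalities of the orbits leaves finitely many reachable points, and the set `P` of all orbit points
of endpoints is finite. A block lies in one gap between first level endpoints and makes the same lazy
choice as that gap (`RealIFS.IsAttractor.block_subset_map_lazyIndex`). So its lazy expanding map
carries it into `K`, and carries its end points to points of `P`; the image is the part of `K`
between two points of `P` (`RealIFS.IsAttractor.exists_expand_block`). As `K` has no isolated points,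
that part is, up to closure, the union of the open blocks in it. This gives the edges, the open set
condition, and the invariance of the closures of the open blocks; contraction gives uniqueness.

*The exponents.* For a strongly connected graph, the Perron–Frobenius theorem
(`Matrix.exists_pos_eigenvector`) identifies `Φ(t)` with the eigenvalue of a positive vector.
Comparing such vectors for different `t` shows that `Φ` is continuous and strictly decreasing, so
that `Φ(t) = 1` has at most one solution, and has one beyond `s` whenever some nonnegative vector
satisfies `0 ≠ N ≤ A^s N`. For a general graph such a vector restricts to one on a strongly connected
component (`GraphSystem.exists_component_of_subinvariant`).

*Upper bound.* The premeasures `ℋ^s_δ` of the pieces form a vector `N ≤ A^s N`. If `s` exceeds all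
exponents of the components, it must vanish, and then the pieces are `ℋ^s`-null. If `A^t` fixes a
positive vector, the recursion bounds `ℋ^t` of the pieces by a multiple of this vector.

*Lower bound.* If `A^t` fixes a positive vector `h`, the cylinder of a path carries the weight given by
`h` at its end times the `t`-th powers of the ratios along it. The total weight of the cylinders of
level `n` that meet an interval is, for large `n`, at most a constant times the `t`-th power of its
length (`GraphSystem.meetWeight_Icc_le`): a short interval meets a single child interval, and can
then be expanded, or it meets two, and then contains an end point of each; from there on it meets at
most one child at every step. A compactness argument takes the place of a limit measure
(`hausdorffMeasure_pos_of_weights`). Applied to the component with the largest exponent, this bounds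
the dimension from below.
-/

open scoped Matrix

noncomputable section

/-! ### Perron–Frobenius theory for irreducible nonnegative matrices -/

namespace Matrix

variable {ι : Type*} [Fintype ι]

theorem mulVec_mono_of_nonneg {A : Matrix ι ι ℝ} (hA : ∀ i j, 0 ≤ A i j) {x y : ι → ℝ}
    (hxy : ∀ i, x i ≤ y i) (i : ι) : (A *ᵥ x) i ≤ (A *ᵥ y) i :=
  Finset.sum_le_sum fun j _ => mul_le_mul_of_nonneg_left (hxy j) (hA i j)

theorem mulVec_nonneg_of_nonneg {A : Matrix ι ι ℝ} (hA : ∀ i j, 0 ≤ A i j) {x : ι → ℝ}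
    (hx : ∀ i, 0 ≤ x i) (i : ι) : 0 ≤ (A *ᵥ x) i :=
  Finset.sum_nonneg fun j _ => mul_nonneg (hA i j) (hx j)

/-- The Collatz–Wielandt comparison: a growth rate `θ` that a nonnegative vector `y` attains from
below never exceeds a rate `ρ` that a positive vector `h` attains from above. -/
theorem le_of_smul_le_mulVec {A : Matrix ι ι ℝ} (hA : ∀ i j, 0 ≤ A i j) {h y : ι → ℝ} {ρ θ : ℝ}
    (hh : ∀ i, 0 < h i) (hAh : ∀ i, (A *ᵥ h) i ≤ ρ * h i) (hy : ∃ i, 0 < y i)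
    (hAy : ∀ i, θ * y i ≤ (A *ᵥ y) i) : θ ≤ ρ := by
  obtain ⟨j, hj⟩ := hy
  obtain ⟨i, -, hi⟩ := Finset.exists_max_image Finset.univ (fun i => y i / h i) ⟨j, Finset.mem_univ j⟩
  set c := y i / h i with hc
  have hcpos : 0 < c := (div_pos hj (hh j)).trans_le (hi j (Finset.mem_univ j))
  have hyc : ∀ k, y k ≤ (c • h) k := fun k => by
    have := hi k (Finset.mem_univ k)
    rwa [div_le_iff₀ (hh k)] at this
  have hyi : y i = c * h i := by rw [hc, div_mul_cancel₀ _ (hh i).ne']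
  have h1 : θ * y i ≤ ρ * y i := calc
    θ * y i ≤ (A *ᵥ y) i := hAy i
    _ ≤ (A *ᵥ (c • h)) i := mulVec_mono_of_nonneg hA hyc i
    _ = c * (A *ᵥ h) i := by rw [mulVec_smul]; rfl
    _ ≤ c * (ρ * h i) := by gcongr; exact hAh i
    _ = ρ * y i := by rw [hyi]; ring
  exact le_of_mul_le_mul_right h1 (hyi ▸ mul_pos hcpos (hh i))

/-- A nonnegative matrix with a positive eigenvector has the eigenvalue of that vector as its
largest nonnegative eigenvalue. -/
theorem isLargestEigenvalue_of_pos_eigenvector [Nonempty ι] {A : Matrix ι ι ℝ}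
    (hA : ∀ i j, 0 ≤ A i j) {h : ι → ℝ} {ρ : ℝ} (hh : ∀ i, 0 < h i) (hAh : A *ᵥ h = ρ • h) :
    A.IsLargestEigenvalue ρ := by
  classical
  obtain ⟨i₀⟩ := ‹Nonempty ι›
  refine ⟨⟨?_, ?_⟩, ?_⟩
  · have h1 := mulVec_nonneg_of_nonneg hA (fun i => (hh i).le) i₀
    rw [hAh, Pi.smul_apply, smul_eq_mul] at h1
    exact nonneg_of_mul_nonneg_left h1 (hh i₀)
  · refine Module.End.hasEigenvalue_of_hasEigenvector (x := h)
      ⟨Module.End.mem_eigenspace_iff.2 ?_, fun h0 => ?_⟩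
    · rw [toLin'_apply, hAh]
    · exact (hh i₀).ne' (congrFun h0 i₀)
  · rintro μ ⟨hμ, hev⟩
    obtain ⟨x, hx⟩ := hev.exists_hasEigenvector
    have hAx : A *ᵥ x = μ • x := by
      have := Module.End.mem_eigenspace_iff.1 hx.1
      rwa [toLin'_apply] at this
    obtain ⟨j, hj⟩ := Function.ne_iff.1 hx.2
    refine le_of_smul_le_mulVec hA hh (fun i => by rw [hAh]; rfl) (y := fun i => |x i|)
      ⟨j, abs_pos.2 hj⟩ fun i => ?_
    calc μ * |x i| = |(A *ᵥ x) i| := by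
          rw [hAx, Pi.smul_apply, smul_eq_mul, abs_mul, abs_of_nonneg hμ]
      _ ≤ ∑ j, |A i j * x j| := Finset.abs_sum_le_sum_abs _ _
      _ = (A *ᵥ fun i => |x i|) i :=
          Finset.sum_congr rfl fun j _ => by rw [abs_mul, abs_of_nonneg (hA i j)]

/-- The optimal growth rate of nonnegative vectors under a nonnegative matrix is attained, since
the normalised vectors form a compact set. -/
theorem exists_max_growth_rate [Nonempty ι] {A : Matrix ι ι ℝ} (hA : ∀ i j, 0 ≤ A i j) :
    ∃ ρ : ℝ, 0 ≤ ρ ∧ (∃ x : ι → ℝ, (∀ i, 0 ≤ x i) ∧ (∃ i, 0 < x i) ∧ ∀ i, ρ * x i ≤ (A *ᵥ x) i) ∧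
      ∀ (y : ι → ℝ) (θ : ℝ), 0 ≤ θ → (∀ i, 0 ≤ y i) → (∃ i, 0 < y i) →
        (∀ i, θ * y i ≤ (A *ᵥ y) i) → θ ≤ ρ := by
  classical
  set B : ℝ := ∑ i, ∑ j, A i j with hB
  have hbound : ∀ x ∈ stdSimplex ℝ ι, ∀ θ : ℝ, (∀ i, θ * x i ≤ (A *ᵥ x) i) → θ ≤ B := by
    intro x hx θ hθ
    have hx1 : ∀ j, x j ≤ 1 := fun j =>
      hx.2 ▸ Finset.single_le_sum (fun i _ => hx.1 i) (Finset.mem_univ j)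
    calc θ = ∑ i, θ * x i := by rw [← Finset.mul_sum, hx.2, mul_one]
      _ ≤ ∑ i, (A *ᵥ x) i := Finset.sum_le_sum fun i _ => hθ i
      _ ≤ B := Finset.sum_le_sum fun i _ => Finset.sum_le_sum fun j _ =>
          mul_le_of_le_one_right (hA i j) (hx1 j)
  set S : Set ((ι → ℝ) × ℝ) :=
    (stdSimplex ℝ ι ×ˢ Icc 0 B) ∩ {p | ∀ i, p.2 * p.1 i ≤ (A *ᵥ p.1) i} with hS
  have hScpt : IsCompact S := by
    refine ((isCompact_stdSimplex ℝ ι).prod isCompact_Icc).inter_right ?_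
    rw [ofPred_forall]
    refine isClosed_iInter fun i => isClosed_le (by fun_prop) ?_
    exact continuous_finsetSum _ fun j _ => by fun_prop
  obtain ⟨i₀⟩ := ‹Nonempty ι›
  have hSne : S.Nonempty := by
    refine ⟨(Pi.single i₀ 1, 0), ⟨single_mem_stdSimplex ℝ i₀, le_rfl, ?_⟩, fun i => ?_⟩
    · exact Finset.sum_nonneg fun i _ => Finset.sum_nonneg fun j _ => hA i j
    · simpa using hA i i₀
  obtain ⟨⟨x, ρ⟩, hxρ, hmax⟩ := hScpt.exists_isMaxOn hSne continuous_snd.continuousOn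
  refine ⟨ρ, hxρ.1.2.1, ⟨x, hxρ.1.1.1, ?_, hxρ.2⟩, fun y θ hθ hy hy0 hAy => ?_⟩
  · by_contra! hcon
    have h0 : ∑ i, x i ≤ 0 := Finset.sum_nonpos fun i _ => hcon i
    have h1 : ∑ i, x i = 1 := hxρ.1.1.2
    linarith
  · set s := ∑ i, y i with hs
    have hspos : 0 < s := by
      obtain ⟨j, hj⟩ := hy0
      exact hj.trans_le (Finset.single_le_sum (fun i _ => hy i) (Finset.mem_univ j))
    have hz : s⁻¹ • y ∈ stdSimplex ℝ ι := by
      refine ⟨fun i => mul_nonneg (inv_nonneg.2 hspos.le) (hy i), ?_⟩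
      simp only [Pi.smul_apply, smul_eq_mul, ← Finset.mul_sum]
      exact inv_mul_cancel₀ hspos.ne'
    have hAz : ∀ i, θ * (s⁻¹ • y) i ≤ (A *ᵥ (s⁻¹ • y)) i := fun i => by
      rw [mulVec_smul, Pi.smul_apply, Pi.smul_apply, smul_eq_mul, smul_eq_mul, mul_left_comm]
      exact mul_le_mul_of_nonneg_left (hAy i) (inv_nonneg.2 hspos.le)
    exact hmax (a := (s⁻¹ • y, θ)) ⟨⟨hz, hθ, hbound _ hz θ hAz⟩, hAz⟩

/-- For an irreducible matrix, high powers of `1 + A` spread the support of a nonnegative vector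
to all indices. -/
theorem exists_one_add_pow_mulVec_pos [DecidableEq ι] {A : Matrix ι ι ℝ} (hA : ∀ i j, 0 ≤ A i j)
    (hirr : ∀ i j, Relation.ReflTransGen (fun i j => 0 < A i j) i j) {z : ι → ℝ}
    (hz : ∀ i, 0 ≤ z i) (hz0 : ∃ i, 0 < z i) : ∃ n : ℕ, ∀ i, 0 < (((1 + A) ^ n) *ᵥ z) i := by
  have hstep : ∀ n, ((1 + A) ^ (n + 1)) *ᵥ z = ((1 + A) ^ n) *ᵥ z + A *ᵥ (((1 + A) ^ n) *ᵥ z) := by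
    intro n
    rw [pow_succ', ← mulVec_mulVec, add_mulVec, one_mulVec]
  have hnn : ∀ n i, 0 ≤ (((1 + A) ^ n) *ᵥ z) i := by
    intro n
    induction n with
    | zero => simpa using hz
    | succ n ih =>
      intro i
      rw [hstep]
      exact add_nonneg (ih i) (mulVec_nonneg_of_nonneg hA ih i)
  have hmono : ∀ i, Monotone fun n => (((1 + A) ^ n) *ᵥ z) i := fun i =>
    monotone_nat_of_le_succ fun n => by
      rw [hstep]
      exact le_add_of_nonneg_right (mulVec_nonneg_of_nonneg hA (hnn n) i)
  obtain ⟨j, hj⟩ := hz0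
  have hex : ∀ i, ∃ n, 0 < (((1 + A) ^ n) *ᵥ z) i := by
    intro i
    induction hirr i j using Relation.ReflTransGen.head_induction_on with
    | refl => exact ⟨0, by simpa using hj⟩
    | head hik _ ih =>
      obtain ⟨n, hn⟩ := ih
      refine ⟨n + 1, ?_⟩
      rw [hstep]
      refine add_pos_of_nonneg_of_pos (hnn n _) ?_
      exact Finset.sum_pos' (fun l _ => mul_nonneg (hA _ l) (hnn n l))
        ⟨_, Finset.mem_univ _, mul_pos hik hn⟩
  choose N hN using hex
  exact ⟨Finset.univ.sup N, fun i => (hN i).trans_le (hmono i (Finset.le_sup (Finset.mem_univ i)))⟩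

/-- The Perron–Frobenius theorem: an irreducible nonnegative matrix has a positive eigenvector.
A vector of optimal growth rate `ρ` is one: otherwise a power of `1 + A`, which commutes with `A`,
would turn the excess `A x - ρ x` into a positive vector, and the rate could be increased. -/
theorem exists_pos_eigenvector [Nonempty ι] {A : Matrix ι ι ℝ} (hA : ∀ i j, 0 ≤ A i j)
    (hirr : ∀ i j, Relation.ReflTransGen (fun i j => 0 < A i j) i j) :
    ∃ (ρ : ℝ) (h : ι → ℝ), 0 ≤ ρ ∧ (∀ i, 0 < h i) ∧ A *ᵥ h = ρ • h := by
  classical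
  obtain ⟨ρ, hρ, ⟨x, hx, hx0, hAx⟩, hmax⟩ := exists_max_growth_rate hA
  have hcomm : ∀ n (v : ι → ℝ), A *ᵥ (((1 + A) ^ n) *ᵥ v) = ((1 + A) ^ n) *ᵥ (A *ᵥ v) := by
    intro n v
    rw [mulVec_mulVec, mulVec_mulVec]
    congr 1
    exact (((Commute.one_right A).add_right (Commute.refl A)).pow_right n).eq
  obtain ⟨n₁, hn₁⟩ := exists_one_add_pow_mulVec_pos hA hirr hx hx0
  have heig : A *ᵥ x = ρ • x := by
    by_contra hne
    set w : ι → ℝ := A *ᵥ x - ρ • x with hw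
    have hwnn : ∀ i, 0 ≤ w i := fun i => sub_nonneg.2 (hAx i)
    have hw0 : ∃ i, 0 < w i := by
      by_contra! hcon
      exact hne (sub_eq_zero.1 (funext fun i => le_antisymm (hcon i) (hwnn i)))
    obtain ⟨n, hn⟩ := exists_one_add_pow_mulVec_pos hA hirr hwnn hw0
    have hpnn : ∀ m i j, 0 ≤ ((1 + A) ^ m : Matrix ι ι ℝ) i j := by
      intro m
      induction m with
      | zero => intro i j; rw [pow_zero, one_apply]; split_ifs <;> norm_num
      | succ m ih =>
        intro i j
        rw [pow_succ, mul_apply]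
        refine Finset.sum_nonneg fun k _ => mul_nonneg (ih i k) ?_
        rw [add_apply, one_apply]
        exact add_nonneg (by split_ifs <;> norm_num) (hA k j)
    set y := ((1 + A) ^ n) *ᵥ x with hy
    have hynn : ∀ i, 0 ≤ y i := mulVec_nonneg_of_nonneg (hpnn n) hx
    have hyw : A *ᵥ y = ρ • y + ((1 + A) ^ n) *ᵥ w := by
      rw [hy, hcomm, hw, mulVec_sub, mulVec_smul]; abel
    have hy0 : ∃ i, 0 < y i := by
      by_contra! hcon
      have hyz : y = 0 := funext fun i => le_antisymm (hcon i) (hynn i)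
      obtain ⟨i, _⟩ := hx0
      have := congrFun hyw i
      rw [hyz, mulVec_zero, smul_zero, zero_add, Pi.zero_apply] at this
      exact (hn i).ne this
    -- a small gain in the growth rate that the positive excess allows at every index
    obtain ⟨i₁, -, hi₁⟩ := Finset.exists_min_image Finset.univ (fun i => (((1 + A) ^ n) *ᵥ w) i)
      ⟨hx0.choose, Finset.mem_univ _⟩
    set s := ∑ i, y i with hs
    have hys : ∀ i, y i ≤ s := fun i => Finset.single_le_sum (fun i _ => hynn i) (Finset.mem_univ i)
    have hspos : 0 < s := by
      obtain ⟨j, hj⟩ := hy0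
      exact hj.trans_le (hys j)
    set ε := (((1 + A) ^ n) *ᵥ w) i₁ / s with hε
    have hεpos : 0 < ε := div_pos (hn i₁) hspos
    have := hmax y (ρ + ε) (by positivity) hynn hy0 fun i => by
      rw [hyw, add_mul, Pi.add_apply, Pi.smul_apply, smul_eq_mul]
      refine add_le_add le_rfl ?_
      calc ε * y i ≤ ε * s := by gcongr; exact hys i
        _ = (((1 + A) ^ n) *ᵥ w) i₁ := by rw [hε, div_mul_cancel₀ _ hspos.ne']
        _ ≤ _ := hi₁ i (Finset.mem_univ i)
    linarith
  have hpow : ∀ n, ((1 + A) ^ n) *ᵥ x = (1 + ρ) ^ n • x := by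
    intro n
    induction n with
    | zero => simp
    | succ n ih =>
      rw [pow_succ, ← mulVec_mulVec, add_mulVec, one_mulVec, heig,
        show x + ρ • x = (1 + ρ) • x by rw [add_smul, one_smul], mulVec_smul, ih, smul_smul,
        pow_succ, mul_comm]
  refine ⟨ρ, x, hρ, fun i => ?_, heig⟩
  have := hn₁ i
  rw [hpow, Pi.smul_apply, smul_eq_mul] at this
  exact pos_of_mul_pos_right this (by positivity)

end Matrix

/-! ### Weighted adjacency matrices of strongly connected graphs -/

namespace GraphSystem

variable {V : Type*}

open Classical in
theorem weightedMatrix_apply (G : GraphSystem V) (t : ℝ) (u v : V) :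
    G.weightedMatrix t u v = if G.Adj u v then |G.ratio u v| ^ t else 0 := rfl

theorem weightedMatrix_of_adj (G : GraphSystem V) (t : ℝ) {u v : V} (h : G.Adj u v) :
    G.weightedMatrix t u v = |G.ratio u v| ^ t := by
  rw [weightedMatrix_apply, if_pos h]

theorem weightedMatrix_of_not_adj (G : GraphSystem V) (t : ℝ) {u v : V} (h : ¬ G.Adj u v) :
    G.weightedMatrix t u v = 0 := by
  rw [weightedMatrix_apply, if_neg h]

theorem weightedMatrix_nonneg (G : GraphSystem V) (t : ℝ) (u v : V) :
    0 ≤ G.weightedMatrix t u v := by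
  rw [weightedMatrix_apply]
  split_ifs
  · positivity
  · exact le_rfl

/-- The graph-directed system induced on a set of vertices. -/
def restrict (G : GraphSystem V) (D : Set V) : GraphSystem D where
  lo u := G.lo u
  hi u := G.hi u
  Adj u v := G.Adj u v
  ratio u v := G.ratio u v
  trans u v := G.trans u v

theorem StronglyConnectedOn.restrict {G : GraphSystem V} {D : Set V} (hD : G.StronglyConnectedOn D)
    (u v : D) : Relation.ReflTransGen (G.restrict D).Adj u v := by
  obtain ⟨u, hu⟩ := u
  obtain ⟨v, hv⟩ := v
  have h := hD.2 u hu v hv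
  induction h using Relation.ReflTransGen.head_induction_on with
  | refl => exact Relation.ReflTransGen.refl
  | head hxy _ ih =>
    have e : (G.restrict D).Adj ⟨_, hxy.1⟩ ⟨_, hxy.2.1⟩ := hxy.2.2
    exact Relation.ReflTransGen.head e (ih hxy.2.1)

/-- The ratios on the edges of a finite graph are bounded away from `0` and `1`. -/
theorem exists_ratio_bounds [Finite V] [Nonempty V] (G : GraphSystem V)
    (hr : ∀ u v, G.Adj u v → G.ratio u v ≠ 0) (hr1 : ∀ u v, G.Adj u v → |G.ratio u v| < 1) :
    ∃ a b : ℝ, 0 < a ∧ a < 1 ∧ 0 < b ∧ b < 1 ∧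
      ∀ u v, G.Adj u v → a ≤ |G.ratio u v| ∧ |G.ratio u v| ≤ b := by
  classical
  set g : V × V → ℝ := fun p => if G.Adj p.1 p.2 then |G.ratio p.1 p.2| else 1 / 2 with hg
  have hg01 : ∀ p, 0 < g p ∧ g p < 1 := by
    intro p
    simp only [hg]
    split_ifs with h
    · exact ⟨abs_pos.2 (hr _ _ h), hr1 _ _ h⟩
    · norm_num
  obtain ⟨p, hp⟩ := Finite.exists_min g
  obtain ⟨q, hq⟩ := Finite.exists_max g
  refine ⟨g p, g q, (hg01 p).1, (hg01 p).2, (hg01 q).1, (hg01 q).2, fun u v h => ?_⟩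
  have hguv : g (u, v) = |G.ratio u v| := if_pos h
  exact ⟨hguv ▸ hp (u, v), hguv ▸ hq (u, v)⟩

theorem weightedMatrix_lower {G : GraphSystem V} {a : ℝ} (ha0 : 0 < a)
    (ha : ∀ u v, G.Adj u v → a ≤ |G.ratio u v|) (hr1 : ∀ u v, G.Adj u v → |G.ratio u v| < 1)
    (s t : ℝ) (u v : V) : a ^ |t - s| * G.weightedMatrix s u v ≤ G.weightedMatrix t u v := by
  by_cases h : G.Adj u v
  · rw [weightedMatrix_of_adj _ _ h, weightedMatrix_of_adj _ _ h]
    have hpos : 0 < |G.ratio u v| := ha0.trans_le (ha u v h)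
    calc a ^ |t - s| * |G.ratio u v| ^ s ≤ |G.ratio u v| ^ (t - s) * |G.ratio u v| ^ s := by
          gcongr
          calc a ^ |t - s| ≤ |G.ratio u v| ^ |t - s| :=
                Real.rpow_le_rpow ha0.le (ha u v h) (abs_nonneg _)
            _ ≤ |G.ratio u v| ^ (t - s) :=
                Real.rpow_le_rpow_of_exponent_ge hpos (hr1 u v h).le (le_abs_self _)
      _ = |G.ratio u v| ^ t := by rw [← Real.rpow_add hpos, sub_add_cancel]
  · rw [weightedMatrix_of_not_adj _ _ h, weightedMatrix_of_not_adj _ _ h, mul_zero]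

theorem weightedMatrix_upper {G : GraphSystem V} {b : ℝ}
    (hr : ∀ u v, G.Adj u v → G.ratio u v ≠ 0)
    (hb : ∀ u v, G.Adj u v → |G.ratio u v| ≤ b) {s t : ℝ} (hst : s ≤ t) (u v : V) :
    G.weightedMatrix t u v ≤ b ^ (t - s) * G.weightedMatrix s u v := by
  by_cases h : G.Adj u v
  · rw [weightedMatrix_of_adj _ _ h, weightedMatrix_of_adj _ _ h]
    have hpos : 0 < |G.ratio u v| := abs_pos.2 (hr u v h)
    calc |G.ratio u v| ^ t = |G.ratio u v| ^ (t - s) * |G.ratio u v| ^ s := by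
          rw [← Real.rpow_add hpos, sub_add_cancel]
      _ ≤ b ^ (t - s) * |G.ratio u v| ^ s := by
          refine mul_le_mul_of_nonneg_right ?_ (by positivity)
          exact Real.rpow_le_rpow hpos.le (hb u v h) (sub_nonneg.2 hst)
  · rw [weightedMatrix_of_not_adj _ _ h, weightedMatrix_of_not_adj _ _ h, mul_zero]

theorem exists_pos_eigenvector [Fintype V] [Nonempty V] {G : GraphSystem V}
    (hr : ∀ u v, G.Adj u v → G.ratio u v ≠ 0)
    (hG : ∀ u v, Relation.ReflTransGen G.Adj u v) (t : ℝ) :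
    ∃ (ρ : ℝ) (h : V → ℝ), 0 ≤ ρ ∧ (∀ u, 0 < h u) ∧ G.weightedMatrix t *ᵥ h = ρ • h := by
  refine Matrix.exists_pos_eigenvector (G.weightedMatrix_nonneg t) fun u v => ?_
  refine Relation.ReflTransGen.mono (fun x y hxy => ?_) _ _ (hG u v)
  rw [weightedMatrix_of_adj _ _ hxy]
  exact Real.rpow_pos_of_pos (abs_pos.2 (hr x y hxy)) t

/-- If some vector is non-decreasing under the weighted matrix of a strongly connected graph at the
exponent `s`, then the spectral radius is at least `1` there; it varies continuously with the
exponent and decays to `0`, so it takes the value `1` at some `t ≥ s`. -/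
theorem exists_fixed_vector_of_le [Fintype V] [Nonempty V] {G : GraphSystem V}
    (hr : ∀ u v, G.Adj u v → G.ratio u v ≠ 0) (hr1 : ∀ u v, G.Adj u v → |G.ratio u v| < 1)
    (hG : ∀ u v, Relation.ReflTransGen G.Adj u v) {s : ℝ} {y : V → ℝ} (hy : ∃ u, 0 < y u)
    (hys : ∀ u, y u ≤ (G.weightedMatrix s *ᵥ y) u) :
    ∃ t, s ≤ t ∧ ∃ h : V → ℝ, (∀ u, 0 < h u) ∧ G.weightedMatrix t *ᵥ h = h := by
  obtain ⟨a, b, ha0, ha1, hb0, hb1, hab⟩ := G.exists_ratio_bounds hr hr1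
  choose ρ h hρ hh hρh using exists_pos_eigenvector hr hG
  have hle : ∀ t u, (G.weightedMatrix t *ᵥ h t) u ≤ ρ t * h t u := fun t u => by rw [hρh]; rfl
  have hlow : ∀ s t, a ^ |t - s| * ρ s ≤ ρ t := fun s t => by
    obtain ⟨u₀⟩ := ‹Nonempty V›
    refine Matrix.le_of_smul_le_mulVec (G.weightedMatrix_nonneg t) (hh t) (hle t) (y := h s)
      ⟨u₀, hh s u₀⟩ fun u => ?_
    calc a ^ |t - s| * ρ s * h s u = a ^ |t - s| * (G.weightedMatrix s *ᵥ h s) u := by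
          rw [hρh, Pi.smul_apply, smul_eq_mul, mul_assoc]
      _ = ∑ v, a ^ |t - s| * G.weightedMatrix s u v * h s v := by
          simp only [Matrix.mulVec, dotProduct, Finset.mul_sum, mul_assoc]
      _ ≤ (G.weightedMatrix t *ᵥ h s) u := Finset.sum_le_sum fun v _ =>
          mul_le_mul_of_nonneg_right
            (weightedMatrix_lower ha0 (fun u v e => (hab u v e).1) hr1 s t u v) (hh s v).le
  have hupp : ∀ s t, s ≤ t → ρ t ≤ b ^ (t - s) * ρ s := fun s t hst => by
    obtain ⟨u₀⟩ := ‹Nonempty V›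
    refine Matrix.le_of_smul_le_mulVec (G.weightedMatrix_nonneg t) (hh s) (fun u => ?_)
      (y := h t) ⟨u₀, hh t u₀⟩ fun u => by rw [hρh]; rfl
    calc (G.weightedMatrix t *ᵥ h s) u ≤ ∑ v, b ^ (t - s) * G.weightedMatrix s u v * h s v :=
          Finset.sum_le_sum fun v _ => mul_le_mul_of_nonneg_right
            (weightedMatrix_upper hr (fun u v e => (hab u v e).2) hst u v) (hh s v).le
      _ = b ^ (t - s) * (G.weightedMatrix s *ᵥ h s) u := by
          simp only [Matrix.mulVec, dotProduct, Finset.mul_sum, mul_assoc]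
      _ = b ^ (t - s) * ρ s * h s u := by rw [hρh, Pi.smul_apply, smul_eq_mul, mul_assoc]
  have hρs : 1 ≤ ρ s := Matrix.le_of_smul_le_mulVec (G.weightedMatrix_nonneg s) (hh s) (hle s) hy
    fun u => by rw [one_mul]; exact hys u
  have hρpos : ∀ t, 0 < ρ t := fun t =>
    lt_of_lt_of_le (mul_pos (Real.rpow_pos_of_pos ha0 _) (one_pos.trans_le hρs)) (hlow s t)
  -- the two-sided multiplicative bounds make `log ρ` Lipschitz
  have hlog : ∀ s t, Real.log (ρ s) - Real.log (ρ t) ≤ -Real.log a * |s - t| := fun s t => by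
    have h1 := Real.log_le_log (mul_pos (Real.rpow_pos_of_pos ha0 _) (hρpos s)) (hlow s t)
    rw [Real.log_mul (Real.rpow_pos_of_pos ha0 _).ne' (hρpos s).ne', Real.log_rpow ha0,
      abs_sub_comm] at h1
    linarith
  have hcont : Continuous fun t => Real.log (ρ t) := by
    refine (LipschitzWith.of_dist_le_mul (K := (-Real.log a).toNNReal) fun s t => ?_).continuous
    rw [Real.coe_toNNReal _ (by linarith [Real.log_neg ha0 ha1]), Real.dist_eq, Real.dist_eq,
      abs_le]
    have h1 := hlog s t
    have h2 := hlog t s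
    rw [abs_sub_comm t s] at h2
    constructor <;> linarith
  obtain ⟨n, hn⟩ := exists_pow_lt_of_lt_one (inv_pos.2 (hρpos s)) hb1
  have hsn : s ≤ s + n := le_add_of_nonneg_right n.cast_nonneg
  have hρn : ρ (s + n) ≤ 1 := by
    refine (hupp s (s + n) hsn).trans ?_
    rw [add_sub_cancel_left, Real.rpow_natCast]
    calc b ^ n * ρ s ≤ (ρ s)⁻¹ * ρ s := by gcongr
      _ = 1 := inv_mul_cancel₀ (hρpos s).ne'
  obtain ⟨t, ht, ht0⟩ := intermediate_value_Icc' hsn hcont.continuousOn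
    (show (0 : ℝ) ∈ Icc _ _ from ⟨Real.log_nonpos (hρpos _).le hρn, Real.log_nonneg hρs⟩)
  have hρt : ρ t = 1 := by
    rw [← Real.exp_log (hρpos t), show Real.log (ρ t) = 0 from ht0, Real.exp_zero]
  exact ⟨t, ht.1, h t, hh t, by rw [hρh, hρt, one_smul]⟩

/-- Two exponents at which a strongly connected graph has a positive fixed vector coincide. -/
theorem fixed_vector_exponent_unique [Fintype V] [Nonempty V] {G : GraphSystem V}
    (hr : ∀ u v, G.Adj u v → G.ratio u v ≠ 0) (hr1 : ∀ u v, G.Adj u v → |G.ratio u v| < 1)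
    {s t : ℝ} {h k : V → ℝ} (hh : ∀ u, 0 < h u) (hk : ∀ u, 0 < k u)
    (hs : G.weightedMatrix s *ᵥ h = h) (ht : G.weightedMatrix t *ᵥ k = k) : s = t := by
  wlog hst : s < t generalizing s t h k
  · rcases (not_lt.1 hst).lt_or_eq with h1 | h1
    · exact (this hk hh ht hs h1).symm
    · exact h1.symm
  exfalso
  obtain ⟨a, b, ha0, ha1, hb0, hb1, hab⟩ := G.exists_ratio_bounds hr hr1
  obtain ⟨u₀⟩ := ‹Nonempty V›
  have h1 : (1 : ℝ) ≤ b ^ (t - s) := by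
    refine Matrix.le_of_smul_le_mulVec (G.weightedMatrix_nonneg t) hh (fun u => ?_)
      (y := k) ⟨u₀, hk u₀⟩ fun u => by rw [ht, one_mul]
    calc (G.weightedMatrix t *ᵥ h) u ≤ ∑ v, b ^ (t - s) * G.weightedMatrix s u v * h v :=
          Finset.sum_le_sum fun v _ => mul_le_mul_of_nonneg_right
            (weightedMatrix_upper hr (fun u v e => (hab u v e).2) hst.le u v) (hh v).le
      _ = b ^ (t - s) * (G.weightedMatrix s *ᵥ h) u := by
          simp only [Matrix.mulVec, dotProduct, Finset.mul_sum, mul_assoc]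
      _ = b ^ (t - s) * h u := by rw [hs]
  exact absurd (Real.rpow_lt_one hb0.le hb1 (sub_pos.2 hst)) (not_lt.2 h1)

/-- On a strongly connected set `D` the equation `Φ_D(t) = 1` means that the restricted matrix
fixes a positive vector. -/
theorem StronglyConnectedOn.phiEqOne_iff {G : GraphSystem V} {D : Set V}
    (hr : ∀ u v, G.Adj u v → G.ratio u v ≠ 0) (hD : G.StronglyConnectedOn D) [inst' : Fintype D] {t : ℝ} :
    G.PhiEqOne D t ↔
      ∃ h : D → ℝ, (∀ u, 0 < h u) ∧ (G.restrict D).weightedMatrix t *ᵥ h = h := by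
  have : Nonempty D := hD.1.to_subtype
  constructor
  · rintro ⟨inst, hΦ⟩
    obtain rfl : inst' = inst := Subsingleton.elim _ _
    obtain ⟨ρ, h, -, hh, hρ⟩ :=
      exists_pos_eigenvector (G := G.restrict D) (fun u v => hr u v) hD.restrict t
    have h1 : ρ = 1 := (Matrix.isLargestEigenvalue_of_pos_eigenvector
      ((G.restrict D).weightedMatrix_nonneg t) hh hρ).unique hΦ
    exact ⟨h, hh, by rw [hρ, h1, one_smul]⟩
  · rintro ⟨h, hh, hfix⟩
    exact ⟨inferInstance, Matrix.isLargestEigenvalue_of_pos_eigenvector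
      ((G.restrict D).weightedMatrix_nonneg t) hh (by rw [hfix, one_smul])⟩

theorem StronglyConnectedOn.phiEqOne_unique [Finite V] {G : GraphSystem V} {D : Set V}
    (hr : ∀ u v, G.Adj u v → G.ratio u v ≠ 0) (hr1 : ∀ u v, G.Adj u v → |G.ratio u v| < 1)
    (hD : G.StronglyConnectedOn D) {s t : ℝ} (hs : G.PhiEqOne D s) (ht : G.PhiEqOne D t) :
    s = t := by
  have := Fintype.ofFinite D
  have : Nonempty D := hD.1.to_subtype
  obtain ⟨h, hh, hsh⟩ := (hD.phiEqOne_iff hr).1 hs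
  obtain ⟨k, hk, htk⟩ := (hD.phiEqOne_iff hr).1 ht
  exact fixed_vector_exponent_unique (G := G.restrict D) (fun u v => hr u v) (fun u v => hr1 u v)
    hh hk hsh htk

/-! ### Strongly connected components carrying a subinvariant vector -/

/-- The vertices that communicate with `u` form a strongly connected component. -/
theorem isStrongComponent_communicating (G : GraphSystem V) (u : V) :
    G.IsStrongComponent {v | Relation.ReflTransGen G.Adj u v ∧ Relation.ReflTransGen G.Adj v u} := by
  set D := {v | Relation.ReflTransGen G.Adj u v ∧ Relation.ReflTransGen G.Adj v u} with hD
  have hpath : ∀ x ∈ D, ∀ y ∈ D, Relation.ReflTransGen (fun x y => x ∈ D ∧ y ∈ D ∧ G.Adj x y) x y := by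
    intro x hx y hy
    have hxy : Relation.ReflTransGen G.Adj x y := hx.2.trans hy.1
    induction hxy using Relation.ReflTransGen.head_induction_on with
    | refl => exact Relation.ReflTransGen.refl
    | head hab hby ih =>
      have hb : _ ∈ D := ⟨hx.1.tail hab, hby.trans hy.2⟩
      exact Relation.ReflTransGen.head ⟨hx, hb, hab⟩ (ih hb)
  refine ⟨⟨⟨u, Relation.ReflTransGen.refl, Relation.ReflTransGen.refl⟩, hpath⟩, ?_⟩
  intro D' hD' hDD' v hv
  have hu : u ∈ D' := hDD' ⟨Relation.ReflTransGen.refl, Relation.ReflTransGen.refl⟩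
  exact ⟨Relation.ReflTransGen.mono (fun _ _ h => h.2.2) _ _ (hD'.2 u hu v hv),
    Relation.ReflTransGen.mono (fun _ _ h => h.2.2) _ _ (hD'.2 v hv u hu)⟩

/-- A nonzero vector `N ≥ 0` with `N ≤ A N` restricts to such a vector on some strongly connected
component: among the vertices of the support, start from one that reaches the fewest others, so
that nothing in the support is reachable from its component without returning to it. -/
theorem exists_component_of_subinvariant [Fintype V] {G : GraphSystem V} {s : ℝ} {N : V → ℝ}
    (hN : ∀ u, 0 ≤ N u) (hN0 : ∃ u, 0 < N u) (hNs : ∀ u, N u ≤ (G.weightedMatrix s *ᵥ N) u) :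
    ∃ D : Set V, G.IsStrongComponent D ∧ (∃ u ∈ D, 0 < N u) ∧ ∀ [Fintype D], ∀ u : D,
      N u ≤ ((G.restrict D).weightedMatrix s *ᵥ fun v : D => N v) u := by
  classical
  set R : V → Finset V := fun u =>
    Finset.univ.filter fun v => Relation.ReflTransGen G.Adj u v ∧ 0 < N v with hR
  obtain ⟨w, hw⟩ := hN0
  obtain ⟨u, hu, hmin⟩ := Finset.exists_min_image (Finset.univ.filter fun u => 0 < N u)
    (fun u => (R u).card) ⟨w, by simpa using hw⟩
  simp only [Finset.mem_filter, Finset.mem_univ, true_and] at hu hmin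
  set D := {v | Relation.ReflTransGen G.Adj u v ∧ Relation.ReflTransGen G.Adj v u} with hD
  have hback : ∀ v, Relation.ReflTransGen G.Adj u v → 0 < N v → v ∈ D := by
    intro v huv hv
    have hsub : R v ⊆ R u := fun x hx => by
      simp only [hR, Finset.mem_filter, Finset.mem_univ, true_and] at hx ⊢
      exact ⟨huv.trans hx.1, hx.2⟩
    have heq := Finset.eq_of_subset_of_card_le hsub (hmin v hv)
    have hmem : u ∈ R v := by
      rw [heq]
      simp only [hR, Finset.mem_filter, Finset.mem_univ, true_and]
      exact ⟨Relation.ReflTransGen.refl, hu⟩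
    simp only [hR, Finset.mem_filter, Finset.mem_univ, true_and] at hmem
    exact ⟨huv, hmem.1⟩
  refine ⟨D, G.isStrongComponent_communicating u,
    ⟨u, ⟨Relation.ReflTransGen.refl, Relation.ReflTransGen.refl⟩, hu⟩, ?_⟩
  intro inst x
  refine (hNs x).trans (le_of_eq ?_)
  have hzero : ∀ v, v ∉ D → G.weightedMatrix s x v * N v = 0 := by
    intro v hv
    by_cases hxv : G.Adj x v
    · have hNv : N v = 0 := by
        by_contra hne
        exact hv (hback v (x.2.1.tail hxv) ((hN v).lt_of_ne' hne))
      rw [hNv, mul_zero]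
    · rw [weightedMatrix_of_not_adj _ _ hxv, zero_mul]
  calc (G.weightedMatrix s *ᵥ N) x = ∑ v, G.weightedMatrix s x v * N v := rfl
    _ = ∑ v ∈ D.toFinset, G.weightedMatrix s x v * N v :=
        (Finset.sum_subset (Finset.subset_univ _) fun v _ hv => hzero v (by simpa using hv)).symm
    _ = ∑ v : D, G.weightedMatrix s x v * N v :=
        Finset.sum_subtype _ (fun v => Set.mem_toFinset) _

/-- A subinvariant vector at the exponent `s` produces a strongly connected component `D` with
`Φ_D(t) = 1` for some `t ≥ s`. -/
theorem exists_phiEqOne_of_subinvariant [Fintype V] {G : GraphSystem V}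
    (hr : ∀ u v, G.Adj u v → G.ratio u v ≠ 0) (hr1 : ∀ u v, G.Adj u v → |G.ratio u v| < 1)
    {s : ℝ} {N : V → ℝ} (hN : ∀ u, 0 ≤ N u) (hN0 : ∃ u, 0 < N u)
    (hNs : ∀ u, N u ≤ (G.weightedMatrix s *ᵥ N) u) :
    ∃ t, s ≤ t ∧ ∃ D, G.IsStrongComponent D ∧ G.PhiEqOne D t := by
  obtain ⟨D, hD, ⟨u, hu, hNu⟩, hsub⟩ := exists_component_of_subinvariant hN hN0 hNs
  have := Fintype.ofFinite D
  have : Nonempty D := ⟨⟨u, hu⟩⟩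
  obtain ⟨t, hst, h, hh, hfix⟩ := exists_fixed_vector_of_le (G := G.restrict D) (fun u v => hr u v)
    (fun u v => hr1 u v) hD.prop.restrict (y := fun v : D => N v) ⟨⟨u, hu⟩, hNu⟩ hsub
  exact ⟨t, hst, D, hD, (hD.prop.phiEqOne_iff hr).2 ⟨h, hh, hfix⟩⟩

/-- In a graph-directed construction the largest exponent `t ≥ 0` at which some strongly connected
component satisfies `Φ_D(t) = 1` exists: there are finitely many components, each contributes at
most one exponent, and the constant vector is subinvariant at the exponent `0`. -/
theorem exists_isGreatest_phiEqOne [Fintype V] [Nonempty V] {G : GraphSystem V}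
    (hG : G.IsGraphDirectedConstruction) :
    ∃ t, IsGreatest {t : ℝ | 0 ≤ t ∧ ∃ D : Set V, G.IsStrongComponent D ∧ G.PhiEqOne D t} t := by
  set T := {t : ℝ | 0 ≤ t ∧ ∃ D : Set V, G.IsStrongComponent D ∧ G.PhiEqOne D t} with hT
  have hfin : T.Finite := by
    refine Set.Finite.subset (Set.finite_iUnion (ι := Set V)
      (f := fun D => {t | G.IsStrongComponent D ∧ G.PhiEqOne D t}) fun D => ?_) ?_
    · refine Set.Subsingleton.finite fun s hs t ht => ?_
      exact hs.1.prop.phiEqOne_unique hG.ratio_ne_zero hG.abs_ratio_lt_one hs.2 ht.2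
    · rintro t ⟨-, D, hD⟩
      exact Set.mem_iUnion.2 ⟨D, hD⟩
  have hne : T.Nonempty := by
    obtain ⟨u₀⟩ := ‹Nonempty V›
    obtain ⟨t, ht, D, hD⟩ := exists_phiEqOne_of_subinvariant (s := 0) (N := fun _ => 1)
      hG.ratio_ne_zero hG.abs_ratio_lt_one (fun _ => zero_le_one) ⟨u₀, one_pos⟩ fun u => by
        obtain ⟨v, huv⟩ := hG.exists_edge u
        calc (1 : ℝ) = G.weightedMatrix 0 u v * 1 := by
              rw [weightedMatrix_of_adj _ _ huv, Real.rpow_zero, mul_one]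
          _ ≤ ∑ v, G.weightedMatrix 0 u v * 1 := Finset.single_le_sum
              (f := fun v => G.weightedMatrix 0 u v * 1)
              (fun v _ => mul_nonneg (G.weightedMatrix_nonneg 0 u v) zero_le_one)
              (Finset.mem_univ v)
    exact ⟨t, ht, D, hD⟩
  exact ⟨sSup T, hne.csSup_mem hfin, fun t ht => le_csSup hfin.bddAbove ht⟩

end GraphSystem

/-! ### Affine images of intervals -/

theorem affine_image_Icc_Ioo {a : ℝ} (b : ℝ) (ha : a ≠ 0) (c d : ℝ) :
    ∃ p q : ℝ, q - p = |a| * (d - c) ∧ (fun x => a * x + b) '' Icc c d = Icc p q ∧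
      (fun x => a * x + b) '' Ioo c d = Ioo p q ∧
      (p = a * c + b ∧ q = a * d + b ∨ p = a * d + b ∧ q = a * c + b) := by
  rcases ha.lt_or_gt with ha' | ha'
  · refine ⟨a * d + b, a * c + b, by rw [abs_of_neg ha']; ring, ?_, ?_, Or.inr ⟨rfl, rfl⟩⟩
    all_goals
      ext z
      simp only [mem_image, mem_Icc, mem_Ioo]
      constructor
      · rintro ⟨x, ⟨h1, h2⟩, rfl⟩
        constructor <;> nlinarith
      · rintro ⟨h1, h2⟩
        refine ⟨(z - b) / a, ⟨?_, ?_⟩, by field_simp; ring⟩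
        · first
            | rw [le_div_iff_of_neg ha']; linarith
            | rw [lt_div_iff_of_neg ha']; linarith
        · first
            | rw [div_le_iff_of_neg ha']; linarith
            | rw [div_lt_iff_of_neg ha']; linarith
  · refine ⟨a * c + b, a * d + b, by rw [abs_of_pos ha']; ring, ?_, ?_, Or.inl ⟨rfl, rfl⟩⟩
    all_goals
      ext z
      simp only [mem_image, mem_Icc, mem_Ioo]
      constructor
      · rintro ⟨x, ⟨h1, h2⟩, rfl⟩
        constructor <;> nlinarith
      · rintro ⟨h1, h2⟩
        refine ⟨(z - b) / a, ⟨?_, ?_⟩, by field_simp; ring⟩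
        · first
            | rw [le_div_iff₀ ha']; linarith
            | rw [lt_div_iff₀ ha']; linarith
        · first
            | rw [div_le_iff₀ ha']; linarith
            | rw [div_lt_iff₀ ha']; linarith

theorem affine_injective {a : ℝ} (b : ℝ) (ha : a ≠ 0) :
    Function.Injective fun x : ℝ => a * x + b := fun x y h => by
  have : a * x = a * y := add_right_cancel h
  exact mul_left_cancel₀ ha this

theorem affine_preimage_Icc {a : ℝ} (b : ℝ) (ha : a ≠ 0) (x y : ℝ) :
    ∃ x' y' : ℝ, y' - x' = (y - x) / |a| ∧ (fun z => a * z + b) ⁻¹' Icc x y = Icc x' y' := by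
  obtain ⟨p, q, hpq, hIcc, -, -⟩ := affine_image_Icc_Ioo (-b / a) (inv_ne_zero ha) x y
  refine ⟨p, q, by rw [hpq, abs_inv, div_eq_inv_mul], ?_⟩
  rw [← hIcc]
  ext z
  simp only [mem_preimage, mem_image]
  constructor
  · intro hz
    exact ⟨_, hz, by field_simp; ring⟩
  · rintro ⟨w, hw, rfl⟩
    convert hw using 1
    field_simp
    ring

/-! ### Upper bounds for the Hausdorff measure of graph-directed sets -/

/-- The `δ`-premeasure `ℋ^d_δ` on the line, computed with covers by sets of diameter at most
`δ`. -/
def hausdorffPremeasure (d : ℝ) (δ : ENNReal) : OuterMeasure ℝ :=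
  OuterMeasure.mkMetric'.pre (fun s => Metric.ediam s ^ d) δ

theorem hausdorffPremeasure_anti (d : ℝ) {δ δ' : ENNReal} (h : δ ≤ δ') (s : Set ℝ) :
    hausdorffPremeasure d δ' s ≤ hausdorffPremeasure d δ s :=
  OuterMeasure.mkMetric'.mono_pre _ h s

theorem hausdorffPremeasure_le (d : ℝ) {δ : ENNReal} {s : Set ℝ} (h : Metric.ediam s ≤ δ) :
    hausdorffPremeasure d δ s ≤ Metric.ediam s ^ d :=
  OuterMeasure.mkMetric'.pre_le h

theorem hausdorffMeasure_eq_iSup_premeasure (d : ℝ) (s : Set ℝ) :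
    μH[d] s = ⨆ (δ : ENNReal) (_ : 0 < δ), hausdorffPremeasure d δ s := by
  rw [Measure.hausdorffMeasure, ← OuterMeasure.coe_mkMetric, OuterMeasure.mkMetric,
    OuterMeasure.mkMetric']
  simp only [OuterMeasure.iSup_apply, hausdorffPremeasure]

theorem hausdorffPremeasure_affine_image_le {d : ℝ} (hd : 0 ≤ d) {a : ℝ} (ha : a ≠ 0) (b : ℝ)
    (δ : ENNReal) (s : Set ℝ) :
    hausdorffPremeasure d (ENNReal.ofReal |a| * δ) ((fun x => a * x + b) '' s) ≤
      ENNReal.ofReal (|a| ^ d) * hausdorffPremeasure d δ s := by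
  have hpos : 0 < |a| ^ d := Real.rpow_pos_of_pos (abs_pos.2 ha) d
  set κ := ENNReal.ofReal (|a| ^ d) with hκ
  have hκ0 : κ ≠ 0 := (ENNReal.ofReal_pos.2 hpos).ne'
  have hκt : κ ≠ ⊤ := ENNReal.ofReal_ne_top
  have hlip : LipschitzWith ‖a‖₊ fun x : ℝ => a * x + b :=
    LipschitzWith.of_dist_le_mul fun x y => by
      rw [Real.dist_eq, Real.dist_eq, add_sub_add_right_eq_sub, ← mul_sub, abs_mul]
      rfl
  have hna : ENNReal.ofReal |a| = (‖a‖₊ : ENNReal) := by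
    rw [← Real.norm_eq_abs, ofReal_norm, enorm_eq_nnnorm]
  have hle : κ⁻¹ • OuterMeasure.comap (fun x => a * x + b)
      (hausdorffPremeasure d (ENNReal.ofReal |a| * δ)) ≤ hausdorffPremeasure d δ := by
    refine OuterMeasure.mkMetric'.le_pre.2 fun s hs => ?_
    have hdiam : Metric.ediam ((fun x => a * x + b) '' s) ≤ ENNReal.ofReal |a| * Metric.ediam s := by
      rw [hna]; exact hlip.ediam_image_le s
    rw [smul_apply, OuterMeasure.comap_apply, smul_eq_mul]
    calc κ⁻¹ * hausdorffPremeasure d (ENNReal.ofReal |a| * δ) ((fun x => a * x + b) '' s)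
        ≤ κ⁻¹ * (κ * Metric.ediam s ^ d) := by
          gcongr
          refine (hausdorffPremeasure_le d (hdiam.trans (by gcongr))).trans ?_
          refine (ENNReal.rpow_le_rpow hdiam hd).trans (le_of_eq ?_)
          rw [ENNReal.mul_rpow_of_nonneg _ _ hd, hκ, ENNReal.ofReal_rpow_of_pos (abs_pos.2 ha)]
      _ = Metric.ediam s ^ d := by rw [← mul_assoc, ENNReal.inv_mul_cancel hκ0 hκt, one_mul]
  have h := hle s
  rw [smul_apply, OuterMeasure.comap_apply, smul_eq_mul] at h
  calc _ = κ * (κ⁻¹ * hausdorffPremeasure d (ENNReal.ofReal |a| * δ) ((fun x => a * x + b) '' s)) := by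
        rw [← mul_assoc, ENNReal.mul_inv_cancel hκ0 hκt, one_mul]
    _ ≤ _ := by gcongr

namespace GraphSystem

variable {V : Type*}

theorem hausdorffPremeasure_le_sum [Fintype V] {G : GraphSystem V}
    (hr : ∀ u v, G.Adj u v → G.ratio u v ≠ 0) {b : ℝ}
    (hb : ∀ u v, G.Adj u v → |G.ratio u v| ≤ b) {C : V → Set ℝ}
    (hC : ∀ u, C u ⊆ ⋃ (v : V) (_ : G.Adj u v), G.map u v '' C v) {s : ℝ} (hs : 0 ≤ s)
    (δ : ENNReal) (u : V) :
    hausdorffPremeasure s (ENNReal.ofReal b * δ) (C u) ≤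
      ∑ v, ENNReal.ofReal (G.weightedMatrix s u v) * hausdorffPremeasure s δ (C v) := by
  refine (measure_mono (hC u)).trans ((measure_iUnion_fintype_le _ _).trans ?_)
  refine Finset.sum_le_sum fun v _ => ?_
  by_cases h : G.Adj u v
  · simp only [h, iUnion_true]
    rw [weightedMatrix_of_adj _ _ h]
    refine (hausdorffPremeasure_anti s ?_ _).trans
      (hausdorffPremeasure_affine_image_le hs (hr u v h) (G.trans u v) δ (C v))
    gcongr
    exact hb u v h
  · simp [h]

/-- A supersolution `h` of the eigenvalue equation that dominates one premeasure of the pieces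
dominates their Hausdorff measure: the recursion passes the bound on to the premeasures at the
scales `b ^ n * δ`. -/
theorem hausdorffMeasure_le_of_supersolution [Fintype V] [Nonempty V] {G : GraphSystem V}
    (hr : ∀ u v, G.Adj u v → G.ratio u v ≠ 0) (hr1 : ∀ u v, G.Adj u v → |G.ratio u v| < 1)
    {C : V → Set ℝ} (hC : ∀ u, C u ⊆ ⋃ (v : V) (_ : G.Adj u v), G.map u v '' C v)
    {s : ℝ} (hs : 0 ≤ s) {h : V → ℝ} (hh : ∀ u, 0 ≤ h u)
    (hle : ∀ u, (G.weightedMatrix s *ᵥ h) u ≤ h u) {δ : ENNReal} (hδ : δ ≠ ⊤)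
    (hpre : ∀ u, hausdorffPremeasure s δ (C u) ≤ ENNReal.ofReal (h u)) (u : V) :
    μH[s] (C u) ≤ ENNReal.ofReal (h u) := by
  obtain ⟨a, b, -, -, hb0, hb1, hab⟩ := G.exists_ratio_bounds hr hr1
  have hall : ∀ (n : ℕ) u,
      hausdorffPremeasure s (ENNReal.ofReal b ^ n * δ) (C u) ≤ ENNReal.ofReal (h u) := by
    intro n
    induction n with
    | zero => simpa using hpre
    | succ n ih =>
      intro u
      rw [pow_succ', mul_assoc]
      refine (hausdorffPremeasure_le_sum hr (fun u v e => (hab u v e).2) hC hs _ u).trans ?_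
      calc ∑ v, ENNReal.ofReal (G.weightedMatrix s u v) *
            hausdorffPremeasure s (ENNReal.ofReal b ^ n * δ) (C v)
          ≤ ∑ v, ENNReal.ofReal (G.weightedMatrix s u v) * ENNReal.ofReal (h v) := by
            gcongr with v; exact ih v
        _ = ENNReal.ofReal ((G.weightedMatrix s *ᵥ h) u) := by
            simp only [← ENNReal.ofReal_mul (G.weightedMatrix_nonneg s u _)]
            exact (ENNReal.ofReal_sum_of_nonneg fun v _ =>
              mul_nonneg (G.weightedMatrix_nonneg s u v) (hh v)).symm
        _ ≤ ENNReal.ofReal (h u) := ENNReal.ofReal_le_ofReal (hle u)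
  rw [hausdorffMeasure_eq_iSup_premeasure]
  refine iSup₂_le fun η hη => ?_
  have hlim : Tendsto (fun n : ℕ => ENNReal.ofReal b ^ n * δ) atTop (𝓝 (0 * δ)) :=
    ENNReal.Tendsto.mul_const
      (ENNReal.tendsto_pow_atTop_nhds_zero_of_lt_one (by simpa using hb1)) (Or.inr hδ)
  rw [zero_mul] at hlim
  obtain ⟨n, hn⟩ := (hlim.eventually (gt_mem_nhds hη)).exists
  exact (hausdorffPremeasure_anti s hn.le _).trans (hall n u)

theorem exists_ediam_bound [Finite V] {C : V → Set ℝ} (hC : ∀ u, IsCompact (C u)) :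
    ∃ δ : ENNReal, δ ≠ ⊤ ∧ ∀ u, Metric.ediam (C u) ≤ δ := by
  cases nonempty_fintype V
  refine ⟨∑ u, Metric.ediam (C u), ?_, fun u =>
    Finset.single_le_sum (f := fun u => Metric.ediam (C u)) (fun _ _ => zero_le) (Finset.mem_univ u)⟩
  exact ENNReal.sum_ne_top.2 fun u _ => (hC u).isBounded.ediam_ne_top

theorem hausdorffPremeasure_ne_top {s : ℝ} (hs : 0 ≤ s) {δ : ENNReal} (hδ : δ ≠ ⊤) {K : Set ℝ}
    (hK : Metric.ediam K ≤ δ) : hausdorffPremeasure s δ K ≠ ⊤ :=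
  ne_top_of_le_ne_top (ENNReal.rpow_ne_top_of_nonneg hs (ne_top_of_le_ne_top hδ hK))
    (hausdorffPremeasure_le s hK)

/-- Beyond the exponents of the strongly connected components the pieces are null sets, since their
premeasures would otherwise form a nonzero subinvariant vector. -/
theorem hausdorffMeasure_eq_zero_of_lt [Fintype V] [Nonempty V] {G : GraphSystem V}
    (hr : ∀ u v, G.Adj u v → G.ratio u v ≠ 0) (hr1 : ∀ u v, G.Adj u v → |G.ratio u v| < 1)
    {C : V → Set ℝ} (hcpt : ∀ u, IsCompact (C u))
    (hC : ∀ u, C u ⊆ ⋃ (v : V) (_ : G.Adj u v), G.map u v '' C v) {s : ℝ} (hs : 0 ≤ s)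
    (hlt : ∀ t D, G.IsStrongComponent D → G.PhiEqOne D t → t < s) (u : V) :
    μH[s] (C u) = 0 := by
  obtain ⟨a, b, -, -, hb0, hb1, hab⟩ := G.exists_ratio_bounds hr hr1
  obtain ⟨δ, hδ, hdiam⟩ := exists_ediam_bound hcpt
  have hfin : ∀ u, hausdorffPremeasure s δ (C u) ≠ ⊤ := fun u =>
    hausdorffPremeasure_ne_top hs hδ (hdiam u)
  set N : V → ℝ := fun u => (hausdorffPremeasure s δ (C u)).toReal with hN
  have hNs : ∀ u, N u ≤ (G.weightedMatrix s *ᵥ N) u := by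
    intro u
    have h1 : hausdorffPremeasure s δ (C u) ≤
        ∑ v, ENNReal.ofReal (G.weightedMatrix s u v) * hausdorffPremeasure s δ (C v) := by
      refine (hausdorffPremeasure_anti s ?_ _).trans
        (hausdorffPremeasure_le_sum hr (fun u v e => (hab u v e).2) hC hs δ u)
      exact mul_le_of_le_one_left zero_le (by simpa using hb1.le)
    have hterm : ∀ v ∈ Finset.univ,
        ENNReal.ofReal (G.weightedMatrix s u v) * hausdorffPremeasure s δ (C v) ≠ ⊤ :=
      fun v _ => ENNReal.mul_ne_top ENNReal.ofReal_ne_top (hfin v)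
    have h2 := ENNReal.toReal_mono (ENNReal.sum_ne_top.2 hterm) h1
    rw [ENNReal.toReal_sum hterm] at h2
    refine h2.trans (le_of_eq (Finset.sum_congr rfl fun v _ => ?_))
    rw [ENNReal.toReal_mul, ENNReal.toReal_ofReal (G.weightedMatrix_nonneg s u v)]
  have hN0 : ∀ u, N u = 0 := by
    by_contra! hne
    obtain ⟨u, hu⟩ := hne
    obtain ⟨t, hst, D, hD, hΦ⟩ := exists_phiEqOne_of_subinvariant (N := N) hr hr1
      (fun u => ENNReal.toReal_nonneg) ⟨u, ENNReal.toReal_nonneg.lt_of_ne' hu⟩ hNs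
    exact absurd (hlt t D hD hΦ) (not_lt.2 hst)
  have hzero := hausdorffMeasure_le_of_supersolution hr hr1 hC hs (h := 0) (fun _ => le_rfl)
    (by simp) hδ (fun u => by
      have := (ENNReal.toReal_eq_zero_iff _).1 (hN0 u)
      simpa using this.resolve_right (hfin u)) u
  simpa using hzero

theorem hausdorffMeasure_lt_top_of_fixed_vector [Fintype V] [Nonempty V] {G : GraphSystem V}
    (hr : ∀ u v, G.Adj u v → G.ratio u v ≠ 0) (hr1 : ∀ u v, G.Adj u v → |G.ratio u v| < 1)
    {C : V → Set ℝ} (hcpt : ∀ u, IsCompact (C u))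
    (hC : ∀ u, C u ⊆ ⋃ (v : V) (_ : G.Adj u v), G.map u v '' C v) {t : ℝ} (ht : 0 ≤ t)
    {h : V → ℝ} (hh : ∀ u, 0 < h u) (hfix : G.weightedMatrix t *ᵥ h = h) (u : V) :
    μH[t] (C u) < ⊤ := by
  obtain ⟨δ, hδ, hdiam⟩ := exists_ediam_bound hcpt
  set N : V → ℝ := fun u => (hausdorffPremeasure t δ (C u)).toReal with hN
  have hN0 : ∀ u, 0 ≤ N u := fun u => ENNReal.toReal_nonneg
  set M := ∑ v, N v / h v with hM
  have hM0 : 0 ≤ M := Finset.sum_nonneg fun v _ => div_nonneg (hN0 v) (hh v).le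
  have hNM : ∀ u, N u ≤ (M • h) u := fun u => by
    rw [Pi.smul_apply, smul_eq_mul, ← div_le_iff₀ (hh u)]
    exact Finset.single_le_sum (f := fun v => N v / h v)
      (fun v _ => div_nonneg (hN0 v) (hh v).le) (Finset.mem_univ u)
  refine (hausdorffMeasure_le_of_supersolution hr hr1 hC ht (h := M • h)
    (fun u => mul_nonneg hM0 (hh u).le) (fun u => by rw [Matrix.mulVec_smul, hfix]) hδ
    (fun u => ?_) u).trans_lt ENNReal.ofReal_lt_top
  rw [← ENNReal.ofReal_toReal (hausdorffPremeasure_ne_top ht hδ (hdiam u))]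
  exact ENNReal.ofReal_le_ofReal (hNM u)

end GraphSystem

/-! ### A mass distribution principle for finitely subadditive weights -/

/-- A set of finite diameter lies in an open interval whose length raised to a power `t ≥ 0`
exceeds the power of the diameter by as little as desired. -/
theorem exists_Ioo_superset_rpow_le {t : ℝ} (ht : 0 ≤ t) {T : Set ℝ} (hT : Metric.ediam T ≠ ⊤)
    {ε : NNReal} (hε : 0 < ε) :
    ∃ x y : ℝ, x < y ∧ T ⊆ Ioo x y ∧ ENNReal.ofReal ((y - x) ^ t) ≤ Metric.ediam T ^ t + ε := by
  have hbdd : Bornology.IsBounded T := Metric.isBounded_iff_ediam_ne_top.2 hT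
  rcases T.eq_empty_or_nonempty with rfl | hne
  · have hcont : Tendsto (fun η : ℝ => η ^ t) (𝓝[>] 0) (𝓝 (0 ^ t)) :=
      ((Real.continuous_rpow_const ht).tendsto 0).mono_left nhdsWithin_le_nhds
    obtain ⟨η, hη, hη0⟩ := ((hcont.eventually (gt_mem_nhds
      (lt_add_of_pos_right (0 ^ t : ℝ) (NNReal.coe_pos.2 hε)))).and self_mem_nhdsWithin).exists
    refine ⟨0, η, hη0, empty_subset _, ?_⟩
    rw [sub_zero, Metric.ediam_empty]
    refine (ENNReal.ofReal_le_ofReal hη.le).trans ?_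
    rw [ENNReal.ofReal_add (Real.rpow_nonneg le_rfl t) ε.coe_nonneg, ENNReal.ofReal_coe_nnreal,
      ← ENNReal.ofReal_rpow_of_nonneg le_rfl ht, ENNReal.ofReal_zero]
  · set d := sSup T - sInf T with hd
    have hd0 : 0 ≤ d := sub_nonneg.2 (csInf_le_csSup hne hbdd.bddBelow hbdd.bddAbove)
    have hcont : Tendsto (fun η : ℝ => (d + 2 * η) ^ t) (𝓝[>] 0) (𝓝 ((d + 2 * 0) ^ t)) := by
      refine Tendsto.mono_left ?_ nhdsWithin_le_nhds
      exact ((Real.continuous_rpow_const ht).comp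
        (continuous_const.add (continuous_const.mul continuous_id))).tendsto 0
    rw [mul_zero, add_zero] at hcont
    obtain ⟨η, hη, hη0⟩ := ((hcont.eventually (gt_mem_nhds
      (lt_add_of_pos_right (d ^ t) (NNReal.coe_pos.2 hε)))).and self_mem_nhdsWithin).exists
    have hη0 : 0 < η := hη0
    refine ⟨sInf T - η, sSup T + η, by linarith, fun z hz => ⟨?_, ?_⟩, ?_⟩
    · linarith [csInf_le hbdd.bddBelow hz]
    · linarith [le_csSup hbdd.bddAbove hz]
    · rw [Real.ediam_eq hbdd, ← hd, ENNReal.ofReal_rpow_of_nonneg hd0 ht,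
        ← ENNReal.ofReal_coe_nnreal, ← ENNReal.ofReal_add (Real.rpow_nonneg hd0 t) ε.coe_nonneg]
      refine ENNReal.ofReal_le_ofReal (le_trans (le_of_eq ?_) hη.le)
      congr 1
      rw [hd]; ring

/-- If finitely subadditive weights `w n` all give the compact set `K` at least the mass `c > 0`,
and eventually give an interval at most a multiple of the `t`-th power of its length, then the
`t`-dimensional Hausdorff measure of `K` is positive. By compactness only finitely many intervals
of a cover count, so that a single `n` serves all of them. -/
theorem hausdorffMeasure_pos_of_weights {K : Set ℝ} (hK : IsCompact K) {t κ c : ℝ} (ht : 0 ≤ t)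
    (hκ : 0 < κ) (hc : 0 < c) (w : ℕ → Set ℝ → ℝ)
    (hsub : ∀ n (s : Finset ℕ) (U : ℕ → Set ℝ), w n (⋃ i ∈ s, U i) ≤ ∑ i ∈ s, w n (U i))
    (htot : ∀ n U, K ⊆ U → c ≤ w n U)
    (hbd : ∀ x y, x < y → ∀ᶠ n in atTop, w n (Icc x y) ≤ κ * (y - x) ^ t) :
    0 < μH[t] K := by
  classical
  refine lt_of_lt_of_le (ENNReal.ofReal_pos.2 (div_pos hc hκ)) ?_
  rw [Measure.hausdorffMeasure_apply]
  refine le_iSup₂_of_le 1 one_pos (le_iInf fun T => le_iInf fun hT => le_iInf fun hdiam => ?_)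
  refine ENNReal.le_of_forall_pos_le_add fun ε hε _ => ?_
  obtain ⟨ε', hε'pos, hε'sum⟩ :=
    ENNReal.exists_pos_sum_of_countable (ENNReal.coe_ne_zero.2 hε.ne') ℕ
  have hT' : ∀ n, Metric.ediam (T n) ≠ ⊤ := fun n => ne_top_of_le_ne_top ENNReal.one_ne_top (hdiam n)
  choose x y hxy hTxy hle using fun n => exists_Ioo_superset_rpow_le ht (hT' n) (hε'pos n)
  set U : ℕ → Set ℝ := fun n => if (T n).Nonempty then Ioo (x n) (y n) else ∅ with hU
  have hUopen : ∀ n, IsOpen (U n) := fun n => by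
    simp only [hU]; split_ifs
    · exact isOpen_Ioo
    · exact isOpen_empty
  have hcover : K ⊆ ⋃ n, U n := fun z hz => by
    obtain ⟨n, hn⟩ := mem_iUnion.1 (hT hz)
    refine mem_iUnion.2 ⟨n, ?_⟩
    simp only [hU, if_pos (show (T n).Nonempty from ⟨z, hn⟩)]
    exact hTxy n hn
  obtain ⟨s, hs⟩ := hK.elim_finite_subcover U hUopen hcover
  set s' := s.filter fun n => (T n).Nonempty with hs'
  have hKs : K ⊆ ⋃ i ∈ s', Icc (x i) (y i) := fun z hz => by
    obtain ⟨i, hi, hzi⟩ := mem_iUnion₂.1 (hs hz)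
    by_cases hne : (T i).Nonempty
    · simp only [hU, if_pos hne] at hzi
      exact mem_iUnion₂.2 ⟨i, Finset.mem_filter.2 ⟨hi, hne⟩, Ioo_subset_Icc_self hzi⟩
    · simp only [hU, if_neg hne] at hzi
      exact hzi.elim
  obtain ⟨n, hn⟩ := ((eventually_all_finset s').2 fun i _ => hbd (x i) (y i) (hxy i)).exists
  have hnn : ∀ i, 0 ≤ (y i - x i) ^ t := fun i => Real.rpow_nonneg (sub_pos.2 (hxy i)).le t
  have hreal : c / κ ≤ ∑ i ∈ s', (y i - x i) ^ t := by
    rw [div_le_iff₀ hκ, mul_comm, Finset.mul_sum]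
    exact (htot n _ hKs).trans ((hsub n s' _).trans (Finset.sum_le_sum hn))
  calc ENNReal.ofReal (c / κ) ≤ ENNReal.ofReal (∑ i ∈ s', (y i - x i) ^ t) :=
        ENNReal.ofReal_le_ofReal hreal
    _ = ∑ i ∈ s', ENNReal.ofReal ((y i - x i) ^ t) :=
        ENNReal.ofReal_sum_of_nonneg fun i _ => hnn i
    _ ≤ ∑ i ∈ s', ((⨆ _ : (T i).Nonempty, Metric.ediam (T i) ^ t) + ε' i) := by
        refine Finset.sum_le_sum fun i hi => ?_
        rw [iSup_pos (Finset.mem_filter.1 hi).2]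
        exact hle i
    _ = ∑ i ∈ s', (⨆ _ : (T i).Nonempty, Metric.ediam (T i) ^ t) + ∑ i ∈ s', (ε' i : ENNReal) :=
        Finset.sum_add_distrib
    _ ≤ _ := add_le_add (ENNReal.sum_le_tsum _) ((ENNReal.sum_le_tsum _).trans hε'sum.le)

/-! ### Lower bounds for the Hausdorff measure of graph-directed sets -/

namespace GraphSystem

variable {V : Type*}

open Classical in
/-- The total weight of the cylinders of level `n` below the vertex `u` that meet `U`, where the
cylinder of a path ending in `v` weighs `h v` times the `t`-th powers of the ratios along the
path. -/
def meetWeight [Fintype V] (G : GraphSystem V) (C : V → Set ℝ) (t : ℝ) (h : V → ℝ) :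
    ℕ → V → Set ℝ → ℝ
  | 0, u, U => if (C u ∩ U).Nonempty then h u else 0
  | n + 1, u, U => ∑ v, G.weightedMatrix t u v * G.meetWeight C t h n v (G.map u v ⁻¹' U)

section MeetWeight

variable [Fintype V] {G : GraphSystem V} {C : V → Set ℝ} {t : ℝ} {h : V → ℝ}

theorem meetWeight_nonneg (hh : ∀ u, 0 ≤ h u) (n : ℕ) (u : V) (U : Set ℝ) :
    0 ≤ G.meetWeight C t h n u U := by
  induction n generalizing u U with
  | zero => rw [meetWeight]; split_ifs; exacts [hh u, le_rfl]
  | succ n ih =>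
    exact Finset.sum_nonneg fun v _ => mul_nonneg (G.weightedMatrix_nonneg t u v) (ih v _)

theorem meetWeight_le (hh : ∀ u, 0 ≤ h u) (hfix : G.weightedMatrix t *ᵥ h = h) (n : ℕ) (u : V)
    (U : Set ℝ) : G.meetWeight C t h n u U ≤ h u := by
  induction n generalizing u U with
  | zero => rw [meetWeight]; split_ifs; exacts [le_rfl, hh u]
  | succ n ih =>
    calc G.meetWeight C t h (n + 1) u U ≤ ∑ v, G.weightedMatrix t u v * h v :=
          Finset.sum_le_sum fun v _ =>
            mul_le_mul_of_nonneg_left (ih v _) (G.weightedMatrix_nonneg t u v)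
      _ = h u := congrFun hfix u

theorem meetWeight_of_superset (hfix : G.weightedMatrix t *ᵥ h = h) (hne : ∀ u, (C u).Nonempty)
    (hC : ∀ u v, G.Adj u v → G.map u v '' C v ⊆ C u) (n : ℕ) (u : V) (U : Set ℝ) (hU : C u ⊆ U) :
    G.meetWeight C t h n u U = h u := by
  induction n generalizing u U with
  | zero => rw [meetWeight, inter_eq_left.2 hU, if_pos (hne u)]
  | succ n ih =>
    calc G.meetWeight C t h (n + 1) u U = ∑ v, G.weightedMatrix t u v * h v := by
          refine Finset.sum_congr rfl fun v _ => ?_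
          by_cases huv : G.Adj u v
          · rw [ih v _ (image_subset_iff.1 ((hC u v huv).trans hU))]
          · rw [weightedMatrix_of_not_adj _ _ huv, zero_mul, zero_mul]
      _ = h u := congrFun hfix u

theorem meetWeight_biUnion_le (hh : ∀ u, 0 ≤ h u) {ι : Type*} (n : ℕ) (u : V) (s : Finset ι)
    (U : ι → Set ℝ) :
    G.meetWeight C t h n u (⋃ i ∈ s, U i) ≤ ∑ i ∈ s, G.meetWeight C t h n u (U i) := by
  induction n generalizing u U with
  | zero =>
    by_cases hmeet : (C u ∩ ⋃ i ∈ s, U i).Nonempty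
    · obtain ⟨z, hz, hzU⟩ := hmeet
      obtain ⟨i, hi, hzi⟩ := mem_iUnion₂.1 hzU
      calc G.meetWeight C t h 0 u (⋃ i ∈ s, U i) ≤ h u := by
            rw [meetWeight]; split_ifs; exacts [le_rfl, hh u]
        _ = G.meetWeight C t h 0 u (U i) := by rw [meetWeight, if_pos ⟨z, hz, hzi⟩]
        _ ≤ _ := Finset.single_le_sum (f := fun i => G.meetWeight C t h 0 u (U i))
            (fun i _ => meetWeight_nonneg hh 0 u _) hi
    · rw [meetWeight, if_neg hmeet]
      exact Finset.sum_nonneg fun i _ => meetWeight_nonneg hh 0 u _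
  | succ n ih =>
    simp only [meetWeight]
    rw [Finset.sum_comm]
    refine Finset.sum_le_sum fun v _ => ?_
    rw [← Finset.mul_sum, preimage_iUnion₂]
    exact mul_le_mul_of_nonneg_left (ih v _) (G.weightedMatrix_nonneg t u v)

end MeetWeight

/-- The images of the intervals of the successors of `u` under the edge maps: they are intervals in
the interval of `u`, with disjoint interiors, and no shorter than a given `e`. -/
theorem IsGraphDirectedConstruction.exists_child_intervals {G : GraphSystem V}
    (hG : G.IsGraphDirectedConstruction) {e : ℝ}
    (he : ∀ u v, G.Adj u v → e ≤ |G.ratio u v| * (G.hi v - G.lo v)) (u : V) :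
    ∃ p q : V → ℝ, (∀ v, G.Adj u v → p v < q v ∧ e ≤ q v - p v ∧ G.lo u ≤ p v ∧ q v ≤ G.hi u ∧
        G.map u v '' Icc (G.lo v) (G.hi v) = Icc (p v) (q v) ∧
        (p v = G.map u v (G.lo v) ∧ q v = G.map u v (G.hi v) ∨
          p v = G.map u v (G.hi v) ∧ q v = G.map u v (G.lo v))) ∧
      ∀ v w, G.Adj u v → G.Adj u w → v ≠ w → q v ≤ p w ∨ q w ≤ p v := by
  have hex : ∀ v, ∃ p q : ℝ, G.Adj u v →
      (p < q ∧ e ≤ q - p ∧ G.lo u ≤ p ∧ q ≤ G.hi u ∧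
        G.map u v '' Icc (G.lo v) (G.hi v) = Icc p q ∧
        (p = G.map u v (G.lo v) ∧ q = G.map u v (G.hi v) ∨
          p = G.map u v (G.hi v) ∧ q = G.map u v (G.lo v))) ∧
      G.map u v '' Ioo (G.lo v) (G.hi v) = Ioo p q := by
    intro v
    by_cases huv : G.Adj u v
    · have hr := hG.ratio_ne_zero u v huv
      obtain ⟨p, q, hlen, hIcc, hIoo, hends⟩ :=
        affine_image_Icc_Ioo (G.trans u v) hr (G.lo v) (G.hi v)
      have hpq : p < q := by
        have := mul_pos (abs_pos.2 hr) (sub_pos.2 (hG.lo_lt_hi v))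
        linarith
      have hsub : Ioo p q ⊆ Ioo (G.lo u) (G.hi u) := hIoo ▸ hG.open_set_subset u v huv
      rw [Ioo_subset_Ioo_iff hpq] at hsub
      exact ⟨p, q, fun _ => ⟨⟨hpq, hlen ▸ he u v huv, hsub.1, hsub.2, hIcc, hends⟩, hIoo⟩⟩
    · exact ⟨0, 0, fun h => absurd h huv⟩
  choose p q hpq using hex
  refine ⟨p, q, fun v hv => (hpq v hv).1, fun v w hv hw hvw => ?_⟩
  have hdisj := hG.open_set_disjoint u v w hv hw hvw
  rw [(hpq v hv).2, (hpq w hw).2, Ioo_disjoint_Ioo] at hdisj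
  have h1 := (hpq v hv).1.1
  have h2 := (hpq w hw).1.1
  by_contra! hcon
  rcases min_le_iff.1 hdisj with h | h <;> rcases le_max_iff.1 h with h' | h' <;> linarith

/-- The scaling step: a bound for a child at the scale `e` gives the same bound for the parent at
the scale `b * e`. -/
theorem weightedMatrix_mul_le {G : GraphSystem V} {u v : V} (huv : G.Adj u v) (hr : G.ratio u v ≠ 0) {t : ℝ} (ht : 0 ≤ t)
    {b κ d e w : ℝ} (hb : |G.ratio u v| ≤ b) (hκ : 0 ≤ κ) (he : 0 ≤ e)
    (hw : w ≤ κ * max (d / |G.ratio u v|) e ^ t) :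
    G.weightedMatrix t u v * w ≤ κ * max d (b * e) ^ t := by
  have hpos := abs_pos.2 hr
  rw [weightedMatrix_of_adj _ _ huv]
  calc |G.ratio u v| ^ t * w ≤ |G.ratio u v| ^ t * (κ * max (d / |G.ratio u v|) e ^ t) := by gcongr
    _ = κ * (|G.ratio u v| * max (d / |G.ratio u v|) e) ^ t := by
        rw [Real.mul_rpow hpos.le (le_max_of_le_right he)]; ring
    _ ≤ κ * max d (b * e) ^ t := by
        refine mul_le_mul_of_nonneg_left (Real.rpow_le_rpow ?_ ?_ ht) hκ
        · exact mul_nonneg hpos.le (le_max_of_le_right he)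
        · rw [mul_max_of_nonneg _ _ hpos.le, mul_div_cancel₀ _ hpos.ne']
          exact max_le_max le_rfl (by gcongr)

section Bounds

variable [Fintype V] {G : GraphSystem V} {C : V → Set ℝ} {t : ℝ} {h : V → ℝ}

theorem meetWeight_eq_zero (hG : G.IsGraphDirectedConstruction)
    (hCI : ∀ u, C u ⊆ Icc (G.lo u) (G.hi u)) (n : ℕ) (u : V) (U : Set ℝ)
    (hU : Icc (G.lo u) (G.hi u) ∩ U = ∅) : G.meetWeight C t h n u U = 0 := by
  induction n generalizing u U with
  | zero =>
    rw [meetWeight, if_neg]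
    rintro ⟨z, hz, hzU⟩
    exact (hU ▸ ⟨hCI u hz, hzU⟩ : z ∈ (∅ : Set ℝ))
  | succ n ih =>
    obtain ⟨p, q, hpq, -⟩ := hG.exists_child_intervals (e := 0) (fun u v _ =>
      mul_nonneg (abs_nonneg _) (sub_pos.2 (hG.lo_lt_hi v)).le) u
    refine Finset.sum_eq_zero fun v _ => ?_
    by_cases huv : G.Adj u v
    · obtain ⟨-, -, hlo, hhi, himg, -⟩ := hpq v huv
      rw [ih v, mul_zero]
      rw [eq_empty_iff_forall_notMem]
      rintro z ⟨hz, hzU⟩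
      have h1 : G.map u v z ∈ Icc (p v) (q v) := himg ▸ mem_image_of_mem _ hz
      exact (hU ▸ ⟨⟨hlo.trans h1.1, h1.2.trans hhi⟩, hzU⟩ : G.map u v z ∈ (∅ : Set ℝ))
    · rw [weightedMatrix_of_not_adj _ _ huv, zero_mul]

/-- Only successors whose interval meets `J` contribute to the weight of `J`. -/
theorem meetWeight_succ_eq_sum (hG : G.IsGraphDirectedConstruction)
    (hCI : ∀ u, C u ⊆ Icc (G.lo u) (G.hi u)) (n : ℕ) (u : V) (J : Set ℝ) (S : Finset V)
    (hS : ∀ v, G.Adj u v → (G.map u v '' Icc (G.lo v) (G.hi v) ∩ J).Nonempty → v ∈ S) :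
    G.meetWeight C t h (n + 1) u J =
      ∑ v ∈ S, G.weightedMatrix t u v * G.meetWeight C t h n v (G.map u v ⁻¹' J) := by
  refine (Finset.sum_subset (Finset.subset_univ S) fun v _ hv => ?_).symm
  by_cases huv : G.Adj u v
  · rw [meetWeight_eq_zero hG hCI, mul_zero]
    rw [eq_empty_iff_forall_notMem]
    rintro z ⟨hz, hzJ⟩
    exact hv (hS v huv ⟨_, mem_image_of_mem _ hz, hzJ⟩)
  · rw [weightedMatrix_of_not_adj _ _ huv, zero_mul]

variable (hG : G.IsGraphDirectedConstruction) (hCI : ∀ u, C u ⊆ Icc (G.lo u) (G.hi u))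
  (ht : 0 ≤ t) (hh : ∀ u, 0 ≤ h u) (hfix : G.weightedMatrix t *ᵥ h = h)
  {b e κ : ℝ} (hb0 : 0 < b) (hb : ∀ u v, G.Adj u v → |G.ratio u v| ≤ b)
  (he0 : 0 < e) (he : ∀ u v, G.Adj u v → e ≤ |G.ratio u v| * (G.hi v - G.lo v))
  (hκ : 0 ≤ κ) (hhκ : ∀ u, h u ≤ κ * e ^ t)

include hG hCI ht hh hfix hb0 hb he0 he hκ hhκ

/-- An interval that is shorter than all child intervals and contains an endpoint of the interval
of `u` meets at most one child interval, and contains one of its endpoints. Hence its weight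
scales without branching. -/
theorem meetWeight_Icc_le_of_endpoint (n : ℕ) (u : V) (x y : ℝ)
    (hu : G.lo u ∈ Icc x y ∨ G.hi u ∈ Icc x y) :
    G.meetWeight C t h n u (Icc x y) ≤ κ * max (y - x) (b ^ n * e) ^ t := by
  classical
  have hbig : ∀ n u, e ≤ max (y - x) (b ^ n * e) →
      G.meetWeight C t h n u (Icc x y) ≤ κ * max (y - x) (b ^ n * e) ^ t := fun n u hle =>
    ((meetWeight_le hh hfix n u _).trans (hhκ u)).trans (by gcongr)
  induction n generalizing u x y with
  | zero => exact hbig 0 u (by simp)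
  | succ n ih =>
    rcases le_or_gt e (y - x) with hlong | hshort
    · exact hbig _ u (le_max_of_le_left hlong)
    obtain ⟨p, q, hpq, hsep⟩ := hG.exists_child_intervals he u
    set S := Finset.univ.filter fun v => G.Adj u v ∧ p v ≤ y ∧ x ≤ q v with hS
    have hmemS : ∀ v, v ∈ S ↔ G.Adj u v ∧ p v ≤ y ∧ x ≤ q v := fun v => by simp [hS]
    rw [meetWeight_succ_eq_sum hG hCI n u (Icc x y) S fun v huv => by
      rintro ⟨z, hz, hzJ⟩
      rw [(hpq v huv).2.2.2.2.1] at hz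
      exact (hmemS v).2 ⟨huv, hz.1.trans hzJ.2, hzJ.1.trans hz.2⟩]
    have hB0 : 0 ≤ κ * max (y - x) (b ^ (n + 1) * e) ^ t :=
      mul_nonneg hκ (Real.rpow_nonneg (le_max_of_le_right (by positivity)) t)
    have hcard : S.card ≤ 1 := by
      refine Finset.card_le_one.2 fun v hv w hw => ?_
      by_contra hvw
      obtain ⟨huv, hv1, hv2⟩ := (hmemS v).1 hv
      obtain ⟨huw, hw1, hw2⟩ := (hmemS w).1 hw
      obtain ⟨-, h1, h2, h3, -⟩ := hpq v huv
      obtain ⟨-, k1, k2, k3, -⟩ := hpq w huw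
      rcases hu with hu | hu <;> rcases hsep v w huv huw hvw with h4 | h4 <;>
        linarith [hu.1, hu.2]
    have hterm : ∀ v ∈ S, G.weightedMatrix t u v * G.meetWeight C t h n v (G.map u v ⁻¹' Icc x y) ≤
        κ * max (y - x) (b ^ (n + 1) * e) ^ t := by
      intro v hv
      obtain ⟨huv, hv1, hv2⟩ := (hmemS v).1 hv
      obtain ⟨h0, h1, h2, h3, -, hends⟩ := hpq v huv
      have hr := hG.ratio_ne_zero u v huv
      obtain ⟨x', y', hlen, hpre⟩ := affine_preimage_Icc (G.trans u v) hr x y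
      have hpre' : G.map u v ⁻¹' Icc x y = Icc x' y' := hpre
      rw [pow_succ', mul_assoc]
      refine weightedMatrix_mul_le huv hr ht (hb u v huv) hκ (by positivity) ?_
      rw [hpre', ← hlen]
      have hend : p v ∈ Icc x y ∨ q v ∈ Icc x y := by
        rcases hu with hu | hu
        · exact Or.inl ⟨hu.1.trans h2, hv1⟩
        · exact Or.inr ⟨hv2, h3.trans hu.2⟩
      refine ih v x' y' ?_ ?_
      · rw [← hpre']
        rcases hends with ⟨hp, hq⟩ | ⟨hp, hq⟩ <;> rcases hend with hend | hend
        · exact Or.inl (by rwa [hp] at hend)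
        · exact Or.inr (by rwa [hq] at hend)
        · exact Or.inr (by rwa [hp] at hend)
        · exact Or.inl (by rwa [hq] at hend)
      · intro n u hle
        exact ((meetWeight_le hh hfix n u _).trans (hhκ u)).trans (by gcongr)
    calc _ ≤ S.card • (κ * max (y - x) (b ^ (n + 1) * e) ^ t) := Finset.sum_le_card_nsmul _ _ _ hterm
      _ ≤ 1 • (κ * max (y - x) (b ^ (n + 1) * e) ^ t) := nsmul_le_nsmul_left hB0 hcard
      _ = _ := one_nsmul _

/-- An interval shorter than all child intervals either meets only one of them, or it meets two,
and contains an endpoint of each. So the weight of an interval branches at most once. -/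
theorem meetWeight_Icc_le (n : ℕ) (u : V) (x y : ℝ) :
    G.meetWeight C t h n u (Icc x y) ≤ 2 * κ * max (y - x) (b ^ n * e) ^ t := by
  classical
  have hbig : ∀ n u x y, e ≤ max (y - x) (b ^ n * e) →
      G.meetWeight C t h n u (Icc x y) ≤ 2 * κ * max (y - x) (b ^ n * e) ^ t :=
    fun n u x y hle => calc
      _ ≤ κ * e ^ t := (meetWeight_le hh hfix n u _).trans (hhκ u)
      _ ≤ 2 * κ * e ^ t := mul_le_mul_of_nonneg_right (by linarith) (by positivity)
      _ ≤ _ := by gcongr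
  induction n generalizing u x y with
  | zero => exact hbig 0 u x y (by simp)
  | succ n ih =>
    rcases le_or_gt e (y - x) with hlong | hshort
    · exact hbig _ u x y (le_max_of_le_left hlong)
    obtain ⟨p, q, hpq, hsep⟩ := hG.exists_child_intervals he u
    set S := Finset.univ.filter fun v => G.Adj u v ∧ p v ≤ y ∧ x ≤ q v with hS
    have hmemS : ∀ v, v ∈ S ↔ G.Adj u v ∧ p v ≤ y ∧ x ≤ q v := fun v => by simp [hS]
    rw [meetWeight_succ_eq_sum hG hCI n u (Icc x y) S fun v huv => by
      rintro ⟨z, hz, hzJ⟩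
      rw [(hpq v huv).2.2.2.2.1] at hz
      exact (hmemS v).2 ⟨huv, hz.1.trans hzJ.2, hzJ.1.trans hz.2⟩]
    have hM0 : 0 ≤ max (y - x) (b ^ (n + 1) * e) ^ t :=
      Real.rpow_nonneg (le_max_of_le_right (by positivity)) t
    by_cases hcase : ∀ v ∈ S, p v ∈ Icc x y ∨ q v ∈ Icc x y
    · have hcard : S.card ≤ 2 := by
        by_contra! hlt
        obtain ⟨v₁, h₁, v₂, h₂, v₃, h₃, h12, h13, h23⟩ := Finset.two_lt_card.1 hlt
        obtain ⟨hu1, ha1, hb1⟩ := (hmemS _).1 h₁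
        obtain ⟨hu2, ha2, hb2⟩ := (hmemS _).1 h₂
        obtain ⟨hu3, ha3, hb3⟩ := (hmemS _).1 h₃
        have hl1 := (hpq _ hu1).2.1
        have hl2 := (hpq _ hu2).2.1
        have hl3 := (hpq _ hu3).2.1
        rcases hsep _ _ hu1 hu2 h12 with h4 | h4 <;> rcases hsep _ _ hu1 hu3 h13 with h5 | h5 <;>
          rcases hsep _ _ hu2 hu3 h23 with h6 | h6 <;> linarith
      have hterm : ∀ v ∈ S, G.weightedMatrix t u v *
          G.meetWeight C t h n v (G.map u v ⁻¹' Icc x y) ≤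
            κ * max (y - x) (b ^ (n + 1) * e) ^ t := by
        intro v hv
        obtain ⟨huv, hv1, hv2⟩ := (hmemS v).1 hv
        obtain ⟨-, -, -, -, -, hends⟩ := hpq v huv
        have hr := hG.ratio_ne_zero u v huv
        obtain ⟨x', y', hlen, hpre⟩ := affine_preimage_Icc (G.trans u v) hr x y
        have hpre' : G.map u v ⁻¹' Icc x y = Icc x' y' := hpre
        rw [pow_succ', mul_assoc]
        refine weightedMatrix_mul_le huv hr ht (hb u v huv) hκ (by positivity) ?_
        rw [hpre', ← hlen]
        refine meetWeight_Icc_le_of_endpoint hG hCI ht hh hfix hb0 hb he0 he hκ hhκ n v x' y' ?_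
        rw [← hpre']
        rcases hends with ⟨hp, hq⟩ | ⟨hp, hq⟩ <;> rcases hcase v hv with hend | hend
        · exact Or.inl (by rwa [hp] at hend)
        · exact Or.inr (by rwa [hq] at hend)
        · exact Or.inr (by rwa [hp] at hend)
        · exact Or.inl (by rwa [hq] at hend)
      calc _ ≤ S.card • (κ * max (y - x) (b ^ (n + 1) * e) ^ t) :=
            Finset.sum_le_card_nsmul _ _ _ hterm
        _ ≤ 2 • (κ * max (y - x) (b ^ (n + 1) * e) ^ t) :=
            nsmul_le_nsmul_left (mul_nonneg hκ hM0) hcard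
        _ = _ := by rw [nsmul_eq_mul]; push_cast; ring
    · -- the interval lies in the interior of a child interval, which is then the only one it meets
      push Not at hcase
      obtain ⟨v, hv, hpv, hqv⟩ := hcase
      obtain ⟨huv, hv1, hv2⟩ := (hmemS v).1 hv
      have hpx : p v < x := by
        by_contra! hcon
        exact hpv ⟨hcon, hv1⟩
      have hyq : y < q v := by
        by_contra! hcon
        exact hqv ⟨hv2, hcon⟩
      have hSv : S = {v} := by
        refine Finset.eq_singleton_iff_unique_mem.2 ⟨hv, fun w hw => ?_⟩
        by_contra hne
        obtain ⟨huw, hw1, hw2⟩ := (hmemS w).1 hw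
        rcases hsep _ _ huw huv hne with h4 | h4 <;> linarith
      rw [hSv, Finset.sum_singleton]
      have hr := hG.ratio_ne_zero u v huv
      obtain ⟨x', y', hlen, hpre⟩ := affine_preimage_Icc (G.trans u v) hr x y
      have hpre' : G.map u v ⁻¹' Icc x y = Icc x' y' := hpre
      rw [pow_succ', mul_assoc b]
      refine weightedMatrix_mul_le huv hr ht (hb u v huv) (by positivity) (by positivity) ?_
      rw [hpre', ← hlen]
      exact ih v x' y'

end Bounds

/-- In a graph-directed construction whose weighted matrix at the exponent `t` fixes a positive
vector, pieces that contain the images of their successors have positive `t`-dimensional Hausdorff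
measure. -/
theorem IsGraphDirectedConstruction.hausdorffMeasure_pos [Fintype V] {G : GraphSystem V}
    (hG : G.IsGraphDirectedConstruction) {C : V → Set ℝ} (hcpt : ∀ u, IsCompact (C u))
    (hne : ∀ u, (C u).Nonempty) (hCI : ∀ u, C u ⊆ Icc (G.lo u) (G.hi u))
    (hC : ∀ u v, G.Adj u v → G.map u v '' C v ⊆ C u) {t : ℝ} (ht : 0 ≤ t) {h : V → ℝ}
    (hh : ∀ u, 0 < h u) (hfix : G.weightedMatrix t *ᵥ h = h) (u : V) : 0 < μH[t] (C u) := by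
  have : Nonempty V := ⟨u⟩
  obtain ⟨a, b, ha0, -, hb0, hb1, hab⟩ := G.exists_ratio_bounds hG.ratio_ne_zero hG.abs_ratio_lt_one
  obtain ⟨v₀, hv₀⟩ := Finite.exists_min fun v => G.hi v - G.lo v
  obtain ⟨u₀, hu₀⟩ := Finite.exists_max h
  set e := a * (G.hi v₀ - G.lo v₀) with he
  have he0 : 0 < e := mul_pos ha0 (sub_pos.2 (hG.lo_lt_hi v₀))
  have hchild : ∀ u v, G.Adj u v → e ≤ |G.ratio u v| * (G.hi v - G.lo v) := fun u v huv =>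
    mul_le_mul (hab u v huv).1 (hv₀ v) (sub_pos.2 (hG.lo_lt_hi v₀)).le (abs_nonneg _)
  have het : 0 < e ^ t := Real.rpow_pos_of_pos he0 t
  set κ := h u₀ / e ^ t with hκ
  have hκ0 : 0 < κ := div_pos (hh u₀) het
  have hhκ : ∀ u, h u ≤ κ * e ^ t := fun u => by
    rw [hκ, div_mul_cancel₀ _ het.ne']; exact hu₀ u
  refine hausdorffMeasure_pos_of_weights (hcpt u) ht (κ := 2 * κ) (by positivity) (hh u)
    (fun n U => G.meetWeight C t h n u U)
    (fun n s U => meetWeight_biUnion_le (fun u => (hh u).le) n u s U)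
    (fun n U hU => (meetWeight_of_superset hfix hne hC n u U hU).ge) fun x y hxy => ?_
  have hlim : Tendsto (fun n : ℕ => b ^ n * e) atTop (𝓝 (0 * e)) :=
    (tendsto_pow_atTop_nhds_zero_of_lt_one hb0.le hb1).mul_const e
  rw [zero_mul] at hlim
  filter_upwards [hlim.eventually (gt_mem_nhds (sub_pos.2 hxy))] with n hn
  have := meetWeight_Icc_le hG hCI ht (fun u => (hh u).le) hfix hb0 (fun u v e => (hab u v e).2) he0
    hchild hκ0.le hhκ n u x y
  rwa [max_eq_left hn.le] at this

end GraphSystem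

/-! ### Invariant vectors and the dimension formula -/

namespace GraphSystem

variable {V : Type*} {G : GraphSystem V}

/-- Invariant vectors of non-empty compact sets agree, because the maps contract: following an
edge path from a point of `C u`, and coming back from any point of `D` at its end, lands
near the point, in `D u`. -/
theorem IsInvariant.subset [Finite V] (hG : G.IsGraphDirectedConstruction) {C D : V → Set ℝ}
    (hC : G.IsInvariant C) (hD : G.IsInvariant D) (u : V) : C u ⊆ D u := by
  have : Nonempty V := ⟨u⟩
  obtain ⟨a, b, -, -, hb0, hb1, hab⟩ := G.exists_ratio_bounds hG.ratio_ne_zero hG.abs_ratio_lt_one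
  have hbdd : Bornology.IsBounded (⋃ v, (C v ∪ D v)) :=
    Bornology.isBounded_iUnion.2 fun v => (hC v).2.1.isBounded.union (hD v).2.1.isBounded
  obtain ⟨M, hM⟩ := Metric.isBounded_iff.1 hbdd
  have key : ∀ (n : ℕ) u, ∀ x ∈ C u, ∃ y ∈ D u, dist x y ≤ b ^ n * M := by
    intro n
    induction n with
    | zero =>
      intro u x hx
      obtain ⟨y, hy⟩ := (hD u).1
      refine ⟨y, hy, ?_⟩
      rw [pow_zero, one_mul]
      exact hM (mem_iUnion.2 ⟨u, Or.inl hx⟩) (mem_iUnion.2 ⟨u, Or.inr hy⟩)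
    | succ n ih =>
      intro u x hx
      rw [(hC u).2.2] at hx
      obtain ⟨v, huv, x', hx', rfl⟩ := mem_iUnion₂.1 hx
      obtain ⟨y', hy', hdist⟩ := ih v x' hx'
      refine ⟨G.map u v y', ?_, ?_⟩
      · rw [(hD u).2.2]
        exact mem_iUnion₂.2 ⟨v, huv, mem_image_of_mem _ hy'⟩
      · rw [map, map, Real.dist_eq, add_sub_add_right_eq_sub, ← mul_sub, abs_mul, ← Real.dist_eq,
          pow_succ', mul_assoc]
        exact mul_le_mul (hab u v huv).2 hdist dist_nonneg hb0.le
  intro x hx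
  rw [← (hD u).2.1.isClosed.closure_eq, Metric.mem_closure_iff]
  intro ε hε
  have hlim : Tendsto (fun n : ℕ => b ^ n * M) atTop (𝓝 (0 * M)) :=
    (tendsto_pow_atTop_nhds_zero_of_lt_one hb0.le hb1).mul_const M
  rw [zero_mul] at hlim
  obtain ⟨n, hn⟩ := (hlim.eventually (gt_mem_nhds hε)).exists
  obtain ⟨y, hy, hdist⟩ := key n u x hx
  exact ⟨y, hy, hdist.trans_lt hn⟩

theorem IsInvariant.eq [Finite V] (hG : G.IsGraphDirectedConstruction) {C D : V → Set ℝ}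
    (hC : G.IsInvariant C) (hD : G.IsInvariant D) : C = D :=
  funext fun u => (hC.subset hG hD u).antisymm (hD.subset hG hC u)

theorem IsGraphDirectedConstruction.restrict (hG : G.IsGraphDirectedConstruction) {D : Set V}
    (hD : ∀ u ∈ D, ∃ v ∈ D, G.Adj u v) : (G.restrict D).IsGraphDirectedConstruction where
  finite_vertices := have := hG.finite_vertices; inferInstance
  lo_lt_hi u := hG.lo_lt_hi u
  disjoint_interiors u v huv := hG.disjoint_interiors u v fun h => huv (Subtype.ext h)
  exists_edge u := by
    obtain ⟨v, hv, huv⟩ := hD u u.2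
    exact ⟨⟨v, hv⟩, huv⟩
  ratio_ne_zero u v := hG.ratio_ne_zero u v
  abs_ratio_lt_one u v := hG.abs_ratio_lt_one u v
  open_set_subset u v := hG.open_set_subset u v
  open_set_disjoint u v w huv huw hvw :=
    hG.open_set_disjoint u v w huv huw fun h => hvw (Subtype.ext h)

theorem IsGraphDirectedConstruction.hausdorffMeasure_pos_of_phiEqOne
    (hG : G.IsGraphDirectedConstruction) {C : V → Set ℝ} (hC : G.IsInvariant C)
    (hCI : ∀ u, C u ⊆ Icc (G.lo u) (G.hi u)) {D : Set V} (hD : G.StronglyConnectedOn D) {t : ℝ}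
    (ht : 0 ≤ t) (hΦ : G.PhiEqOne D t) {u : V} (hu : u ∈ D) : 0 < μH[t] (C u) := by
  have := hG.finite_vertices
  have := Fintype.ofFinite D
  obtain ⟨h, hh, hfix⟩ := (hD.phiEqOne_iff hG.ratio_ne_zero).1 hΦ
  have hedge : ∀ u ∈ D, ∃ v ∈ D, G.Adj u v := by
    intro u hu
    by_contra! hcon
    refine (hh ⟨u, hu⟩).ne' ?_
    rw [← congrFun hfix ⟨u, hu⟩]
    refine Finset.sum_eq_zero fun v _ => ?_
    exact mul_eq_zero_of_left
      (weightedMatrix_of_not_adj (G.restrict D) t (u := ⟨u, hu⟩) (hcon v v.2)) _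
  refine (hG.restrict hedge).hausdorffMeasure_pos (C := fun v : D => C v) (fun v => (hC v).2.1)
    (fun v => (hC v).1) (fun v => hCI v) (fun v w hvw => ?_) ht hh hfix ⟨u, hu⟩
  have hvw' : G.Adj v w := hvw
  conv_rhs => rw [(hC v).2.2]
  exact subset_iUnion₂_of_subset (w : V) hvw' Subset.rfl

/-- The dimension of a graph-directed self-similar set is the largest exponent `t` at which some
strongly connected component has spectral radius `1`. -/
theorem IsGraphDirectedConstruction.dimH_eq (hG : G.IsGraphDirectedConstruction)
    {C : V → Set ℝ} (hC : G.IsInvariant C) (hCI : ∀ u, C u ⊆ Icc (G.lo u) (G.hi u)) {t : ℝ}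
    (ht : IsGreatest {t : ℝ | 0 ≤ t ∧ ∃ D : Set V, G.IsStrongComponent D ∧ G.PhiEqOne D t} t) :
    dimH (⋃ u, C u) = ENNReal.ofReal t := by
  have := hG.finite_vertices
  have := Fintype.ofFinite V
  obtain ⟨⟨ht0, D, hD, hΦ⟩, hmax⟩ := ht
  obtain ⟨u, hu⟩ := hD.prop.1
  have : Nonempty V := ⟨u⟩
  refine le_antisymm ?_ ?_
  · refine ENNReal.le_of_forall_pos_le_add fun ε hε _ => ?_
    have hs : (0 : ℝ) ≤ t + ε := by positivity
    have hzero : μH[t + ε] (⋃ u, C u) = 0 := by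
      refine measure_iUnion_null fun u => ?_
      refine hausdorffMeasure_eq_zero_of_lt hG.ratio_ne_zero hG.abs_ratio_lt_one
        (fun u => (hC u).2.1) (fun u => (hC u).2.2.subset) hs (fun t' D' hD' hΦ' => ?_) u
      have hεpos : (0 : ℝ) < ε := hε
      rcases lt_or_ge t' 0 with h0 | h0
      · exact h0.trans_le hs
      · exact (hmax ⟨h0, D', hD', hΦ'⟩).trans_lt (lt_add_of_pos_right t hεpos)
    have hle : dimH (⋃ u, C u) ≤ ((t.toNNReal + ε : NNReal) : ENNReal) := by
      refine dimH_le_of_hausdorffMeasure_ne_top ?_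
      rw [NNReal.coe_add, Real.coe_toNNReal t ht0, hzero]
      exact ENNReal.zero_ne_top
    rwa [ENNReal.coe_add] at hle
  · refine le_dimH_of_hausdorffMeasure_ne_zero ?_
    rw [Real.coe_toNNReal t ht0]
    exact ((hG.hausdorffMeasure_pos_of_phiEqOne hC hCI hD.prop ht0 hΦ hu).trans_le
      (measure_mono (subset_iUnion C u))).ne'

/-- In the strongly connected case the Hausdorff measure in the critical dimension is positive and
finite. -/
theorem IsGraphDirectedConstruction.hausdorffMeasure_of_stronglyConnected
    (hG : G.IsGraphDirectedConstruction) {C : V → Set ℝ} (hC : G.IsInvariant C)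
    (hCI : ∀ u, C u ⊆ Icc (G.lo u) (G.hi u)) (hconn : G.StronglyConnectedOn univ) {t : ℝ}
    (ht : IsGreatest {t : ℝ | 0 ≤ t ∧ ∃ D : Set V, G.IsStrongComponent D ∧ G.PhiEqOne D t} t) :
    (∀ t' : ℝ, 0 ≤ t' → (G.PhiEqOne univ t' ↔ t' = t)) ∧
      0 < μH[t] (⋃ u, C u) ∧ μH[t] (⋃ u, C u) < ⊤ := by
  have := hG.finite_vertices
  have := Fintype.ofFinite V
  obtain ⟨⟨ht0, D, hD, hΦ⟩, -⟩ := ht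
  obtain rfl : D = univ := hD.eq_of_subset hconn (subset_univ D)
  obtain ⟨u, hu⟩ := hconn.1
  refine ⟨fun t' _ => ⟨fun h' => hconn.phiEqOne_unique hG.ratio_ne_zero hG.abs_ratio_lt_one h' hΦ,
    fun h' => h' ▸ hΦ⟩, ?_, ?_⟩
  · exact (hG.hausdorffMeasure_pos_of_phiEqOne hC hCI hconn ht0 hΦ hu).trans_le
      (measure_mono (subset_iUnion C u))
  · have : Nonempty (univ : Set V) := ⟨⟨u, hu⟩⟩
    have := Fintype.ofFinite (univ : Set V)
    obtain ⟨h, hh, hfix⟩ := (hconn.phiEqOne_iff hG.ratio_ne_zero).1 hΦ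
    have hfin : ∀ u, μH[t] (C u) < ⊤ := fun u => by
      refine hausdorffMeasure_lt_top_of_fixed_vector (G := G.restrict univ)
        (C := fun v : (univ : Set V) => C v) (fun u v => hG.ratio_ne_zero u v)
        (fun u v => hG.abs_ratio_lt_one u v) (fun v => (hC v).2.1) (fun v z hz => ?_) ht0 hh hfix
        ⟨u, mem_univ u⟩
      rw [(hC v).2.2] at hz
      obtain ⟨w, hvw, hzw⟩ := mem_iUnion₂.1 hz
      exact mem_iUnion₂.2 ⟨⟨w, mem_univ w⟩, hvw, hzw⟩
    exact (measure_iUnion_fintype_le _ _).trans_lt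
      (ENNReal.sum_lt_top.2 fun u _ => hfin u)

end GraphSystem

namespace RealIFS

variable {m : ℕ}

/-! ### The attractor and its codings -/

theorem map_injective (F : RealIFS m) (i : Fin m) : Function.Injective (F.map i) :=
  affine_injective (F.trans i) (F.ratio_ne_zero i)

theorem continuous_map (F : RealIFS m) (i : Fin m) : Continuous (F.map i) := by
  unfold map; fun_prop

theorem continuous_expand (F : RealIFS m) (i : Fin m) : Continuous (F.expand i) := by
  unfold expand; fun_prop

theorem expand_map (F : RealIFS m) (i : Fin m) (x : ℝ) : F.expand i (F.map i x) = x := by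
  have := F.ratio_ne_zero i
  simp only [expand, map]
  field_simp
  ring

theorem map_expand (F : RealIFS m) (i : Fin m) (x : ℝ) : F.map i (F.expand i x) = x := by
  have := F.ratio_ne_zero i
  simp only [expand, map]
  field_simp
  ring

theorem dist_map (F : RealIFS m) (i : Fin m) (x y : ℝ) :
    dist (F.map i x) (F.map i y) = |F.ratio i| * dist x y := by
  rw [map, map, Real.dist_eq, add_sub_add_right_eq_sub, ← mul_sub, abs_mul, ← Real.dist_eq]

theorem exists_ratio_bound (F : RealIFS m) : ∃ b : ℝ, 0 ≤ b ∧ b < 1 ∧ ∀ i, |F.ratio i| ≤ b := by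
  rcases isEmpty_or_nonempty (Fin m) with h | h
  · exact ⟨0, le_rfl, one_pos, fun i => isEmptyElim i⟩
  · obtain ⟨i, hi⟩ := Finite.exists_max fun i => |F.ratio i|
    exact ⟨_, abs_nonneg _, F.abs_ratio_lt_one i, hi⟩

theorem prefixMap_succ' (F : RealIFS m) (ω : ℕ → Fin m) (n : ℕ) :
    F.prefixMap ω (n + 1) = F.map (ω 0) ∘ F.prefixMap (fun k => ω (k + 1)) n := by
  induction n with
  | zero => rfl
  | succ n ih => rw [prefixMap, ih]; rfl

theorem orbitPoint_succ' (F : RealIFS m) (ω : ℕ → Fin m) (x : ℝ) (n : ℕ) :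
    F.orbitPoint ω x (n + 1) = F.orbitPoint (fun k => ω (k + 1)) (F.expand (ω 0) x) n := by
  induction n with
  | zero => rfl
  | succ n ih => rw [orbitPoint, ih]; rfl

theorem prefixMap_orbitPoint (F : RealIFS m) (ω : ℕ → Fin m) (x : ℝ) (n : ℕ) :
    F.prefixMap ω n (F.orbitPoint ω x n) = x := by
  induction n with
  | zero => rfl
  | succ n ih => rw [prefixMap, Function.comp_apply, orbitPoint, map_expand, ih]

theorem dist_prefixMap_le {F : RealIFS m} {b : ℝ} (hb0 : 0 ≤ b) (hb : ∀ i, |F.ratio i| ≤ b)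
    (ω : ℕ → Fin m) (n : ℕ) (x y : ℝ) :
    dist (F.prefixMap ω n x) (F.prefixMap ω n y) ≤ b ^ n * dist x y := by
  induction n generalizing x y with
  | zero => simp [prefixMap]
  | succ n ih =>
    refine (ih _ _).trans ?_
    rw [dist_map, pow_succ, mul_assoc]
    gcongr
    exact hb _

section Attractor

variable {F : RealIFS m} {K : Set ℝ}

theorem IsAttractor.map_mem (hK : F.IsAttractor K) (i : Fin m) {x : ℝ} (hx : x ∈ K) :
    F.map i x ∈ K := by
  rw [hK.2.2]
  exact mem_iUnion.2 ⟨i, mem_image_of_mem _ hx⟩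

theorem IsAttractor.exists_map_eq (hK : F.IsAttractor K) {x : ℝ} (hx : x ∈ K) :
    ∃ i, ∃ y ∈ K, F.map i y = x := by
  rw [hK.2.2] at hx
  exact mem_iUnion.1 hx

theorem IsAttractor.prefixMap_mem (hK : F.IsAttractor K) (ω : ℕ → Fin m) (n : ℕ) {x : ℝ}
    (hx : x ∈ K) : F.prefixMap ω n x ∈ K := by
  induction n generalizing x with
  | zero => exact hx
  | succ n ih => exact ih (hK.map_mem _ hx)

/-- A sequence codes `x` exactly if the orbit of `x` along it stays in the attractor. -/
theorem IsAttractor.isCoding_iff (hK : F.IsAttractor K) {ω : ℕ → Fin m} {x : ℝ} :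
    F.IsCoding ω x ↔ ∀ n, F.orbitPoint ω x n ∈ K := by
  obtain ⟨b, hb0, hb1, hb⟩ := F.exists_ratio_bound
  have hlim : ∀ M : ℝ, Tendsto (fun n : ℕ => b ^ n * M) atTop (𝓝 0) := fun M => by
    simpa using (tendsto_pow_atTop_nhds_zero_of_lt_one hb0 hb1).mul_const M
  constructor
  · intro h n
    induction n generalizing ω x with
    | zero =>
      obtain ⟨y, hy⟩ := hK.1
      have hy' : Tendsto (fun n => F.prefixMap ω n y) atTop (𝓝 x) := by
        refine h.congr_dist (squeeze_zero (fun _ => dist_nonneg)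
          (fun n => dist_prefixMap_le hb0 hb ω n 0 y) (hlim _))
      exact hK.2.1.isClosed.mem_of_tendsto hy' (Eventually.of_forall fun n =>
        hK.prefixMap_mem ω n hy)
    | succ n ih =>
      rw [orbitPoint_succ']
      refine ih ?_
      have h1 := ((F.continuous_expand (ω 0)).tendsto x).comp ((tendsto_add_atTop_iff_nat 1).2 h)
      refine h1.congr fun n => ?_
      rw [Function.comp_apply, prefixMap_succ', Function.comp_apply, expand_map]
  · intro h
    obtain ⟨M, hM⟩ := hK.2.1.isBounded.exists_norm_le
    refine tendsto_iff_dist_tendsto_zero.2 (squeeze_zero (fun _ => dist_nonneg) (fun n => ?_)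
      (hlim M))
    conv_lhs => rw [← F.prefixMap_orbitPoint ω x n]
    refine (dist_prefixMap_le hb0 hb ω n _ _).trans ?_
    rw [dist_zero_left]
    gcongr
    exact hM _ (h n)

/-- A nontrivial attractor has no isolated points. -/
theorem IsAttractor.exists_mem_ne_dist_lt (hK : F.IsAttractor K) (hnt : K.Nontrivial) {x : ℝ}
    (hx : x ∈ K) {ε : ℝ} (hε : 0 < ε) : ∃ y ∈ K, y ≠ x ∧ dist y x < ε := by
  obtain ⟨b, hb0, hb1, hb⟩ := F.exists_ratio_bound
  obtain ⟨M, hM⟩ := Metric.isBounded_iff.1 hK.2.1.isBounded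
  have key : ∀ (n : ℕ), ∀ x ∈ K, ∃ y ∈ K, y ≠ x ∧ dist y x ≤ b ^ n * M := by
    intro n
    induction n with
    | zero =>
      intro x hx
      obtain ⟨y, hy, hyx⟩ := hnt.exists_ne x
      exact ⟨y, hy, hyx, by rw [pow_zero, one_mul]; exact hM hy hx⟩
    | succ n ih =>
      intro x hx
      obtain ⟨i, x', hx', rfl⟩ := hK.exists_map_eq hx
      obtain ⟨y', hy', hne, hdist⟩ := ih x' hx'
      refine ⟨_, hK.map_mem i hy', fun h => hne (F.map_injective i h), ?_⟩
      rw [dist_map, pow_succ', mul_assoc]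
      exact mul_le_mul (hb i) hdist dist_nonneg hb0
  have hlim : Tendsto (fun n : ℕ => b ^ n * M) atTop (𝓝 0) := by
    simpa using (tendsto_pow_atTop_nhds_zero_of_lt_one hb0 hb1).mul_const M
  obtain ⟨n, hn⟩ := (hlim.eventually (gt_mem_nhds hε)).exists
  obtain ⟨y, hy, hne, hdist⟩ := key n x hx
  exact ⟨y, hy, hne, hdist.trans_lt hn⟩

/-- Removing finitely many points does not change the local closure of a nontrivial attractor. -/
theorem IsAttractor.subset_closure_diff_finite (hK : F.IsAttractor K) (hnt : K.Nontrivial)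
    {P U : Set ℝ} (hP : P.Finite) (hU : IsOpen U) : U ∩ K ⊆ closure ((U ∩ K) \ P) := by
  rintro x ⟨hxU, hxK⟩
  refine mem_closure_iff.2 fun W hW hxW => ?_
  have hopen : IsOpen (W ∩ U ∩ (P \ {x})ᶜ) :=
    (hW.inter hU).inter (hP.subset sdiff_subset).isClosed.isOpen_compl
  obtain ⟨ε, hε, hball⟩ := Metric.isOpen_iff.1 hopen x ⟨⟨hxW, hxU⟩, fun h => h.2 rfl⟩
  obtain ⟨y, hy, hne, hdist⟩ := hK.exists_mem_ne_dist_lt hnt hxK hε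
  have hyb := hball (Metric.mem_ball.2 hdist)
  exact ⟨y, hyb.1.1, ⟨hyb.1.2, hy⟩, fun hyP => hyb.2 ⟨hyP, hne⟩⟩

/-! ### Finiteness of the endpoint orbits -/

/-- `y` is an `n`-th point on an orbit of `x` inside `K`. -/
def OrbitReaches (F : RealIFS m) (K : Set ℝ) : ℕ → ℝ → ℝ → Prop
  | 0, x, y => x = y
  | n + 1, x, y => ∃ i, ∃ z ∈ K, F.map i z = x ∧ F.OrbitReaches K n z y

theorem OrbitReaches.trans {n k : ℕ} {x y z : ℝ} (h : F.OrbitReaches K n x y)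
    (h' : F.OrbitReaches K k y z) : F.OrbitReaches K (n + k) x z := by
  induction n generalizing x with
  | zero =>
    obtain rfl : x = y := h
    rwa [zero_add]
  | succ n ih =>
    obtain ⟨i, w, hw, hwx, hwy⟩ := h
    rw [Nat.succ_add]
    exact ⟨i, w, hw, hwx, ih hwy⟩

theorem orbitReaches_orbitPoint {ω : ℕ → Fin m} {x : ℝ} (h : ∀ n, F.orbitPoint ω x n ∈ K)
    (k n : ℕ) : F.OrbitReaches K n (F.orbitPoint ω x k) (F.orbitPoint ω x (k + n)) := by
  induction n generalizing k with
  | zero => rfl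
  | succ n ih =>
    refine ⟨ω k, F.orbitPoint ω x (k + 1), h _, F.map_expand _ _, ?_⟩
    rw [show k + (n + 1) = (k + 1) + n by ring]
    exact ih (k + 1)

theorem IsAttractor.exists_coding (hK : F.IsAttractor K) {x : ℝ} (hx : x ∈ K) :
    ∃ ω, ∀ n, F.orbitPoint ω x n ∈ K := by
  have hstep : ∀ y : K, ∃ (i : Fin m) (z : K), F.map i z = y := fun y => by
    obtain ⟨i, z, hz, hzy⟩ := hK.exists_map_eq y.2
    exact ⟨i, ⟨z, hz⟩, hzy⟩
  choose i z hz using hstep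
  refine ⟨fun n => i (z^[n] ⟨x, hx⟩), fun n => ?_⟩
  have h : F.orbitPoint (fun n => i (z^[n] ⟨x, hx⟩)) x n = z^[n] ⟨x, hx⟩ := by
    induction n with
    | zero => rfl
    | succ n ih =>
      rw [orbitPoint, ih, Function.iterate_succ_apply', ← hz (z^[n] ⟨x, hx⟩), expand_map]
  rw [h]
  exact Subtype.prop _

theorem IsAttractor.exists_coding_of_orbitReaches (hK : F.IsAttractor K) {n : ℕ} {x y : ℝ}
    (hx : x ∈ K) (h : F.OrbitReaches K n x y) :
    ∃ ω, (∀ k, F.orbitPoint ω x k ∈ K) ∧ F.orbitPoint ω x n = y := by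
  induction n generalizing x with
  | zero =>
    obtain ⟨ω, hω⟩ := hK.exists_coding hx
    exact ⟨ω, hω, h⟩
  | succ n ih =>
    obtain ⟨i, z, hz, rfl, hzy⟩ := h
    obtain ⟨ω, hω, hωy⟩ := ih hz hzy
    have hshift : ∀ k, F.orbitPoint (fun k => Nat.casesOn k i ω) (F.map i z) (k + 1) =
        F.orbitPoint ω z k := fun k => by
      rw [orbitPoint_succ']
      change F.orbitPoint ω (F.expand i (F.map i z)) k = _
      rw [expand_map]
    refine ⟨fun k => Nat.casesOn k i ω, fun k => ?_, by rw [hshift, hωy]⟩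
    cases k with
    | zero => exact hx
    | succ k => rw [hshift]; exact hω k

theorem finite_setOf_orbitReaches (F : RealIFS m) (K : Set ℝ) (n : ℕ) (x : ℝ) :
    {y | F.OrbitReaches K n x y}.Finite := by
  induction n generalizing x with
  | zero => exact (finite_singleton x).subset fun y (hy : x = y) => hy.symm
  | succ n ih =>
    refine (finite_iUnion fun i => ih (F.expand i x)).subset ?_
    rintro y ⟨i, z, -, rfl, hzy⟩
    exact mem_iUnion.2 ⟨i, (F.expand_map i z).symm ▸ hzy⟩

/-- Along a shortest way to a point of the orbits of `x` no point is repeated, so a bound for the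
cardinalities of the orbits bounds the length of the way. -/
theorem IsAttractor.finite_orbits (hK : F.IsAttractor K) {x : ℝ} (hx : x ∈ K)
    (hper : F.IsPeriodicPt x) : {y | ∃ n, F.OrbitReaches K n x y}.Finite := by
  classical
  obtain ⟨M, hM⟩ := hper
  refine ((finite_lt_nat M).biUnion fun n _ => F.finite_setOf_orbitReaches K n x).subset ?_
  intro y hy
  set n := Nat.find hy with hn
  have hny : F.OrbitReaches K n x y := Nat.find_spec hy
  refine mem_iUnion₂.2 ⟨n, ?_, hny⟩
  obtain ⟨ω, hω, hωy⟩ := hK.exists_coding_of_orbitReaches hx hny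
  have hne : ∀ i j, i < j → j ≤ n → F.orbitPoint ω x i ≠ F.orbitPoint ω x j := by
    intro i j hij hjn heq
    have h1 : F.OrbitReaches K i x (F.orbitPoint ω x i) := by
      simpa [orbitPoint] using orbitReaches_orbitPoint hω 0 i
    have h2 : F.OrbitReaches K (n - j) (F.orbitPoint ω x j) y := by
      have := orbitReaches_orbitPoint hω j (n - j)
      rwa [Nat.add_sub_cancel' hjn, hωy] at this
    rw [heq] at h1
    exact Nat.find_min hy (m := i + (n - j)) (by omega) (h1.trans h2)
  have hinj : InjOn (F.orbitPoint ω x) (Finset.range (n + 1) : Set ℕ) := by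
    intro i hi j hj hij
    simp only [Finset.coe_range, mem_Iio] at hi hj
    rcases lt_trichotomy i j with h | h | h
    · exact absurd hij (hne i j h (by omega))
    · exact h
    · exact absurd hij.symm (hne j i h (by omega))
  have hcard : ((n + 1 : ℕ) : ℕ∞) ≤ (F.orbitSet ω x).encard := by
    rw [← Finset.card_range (n + 1), ← encard_coe_eq_coe_finsetCard, ← hinj.encard_image]
    exact encard_le_encard (image_subset_range _ _)
  have := hcard.trans_lt (hM ω (hK.isCoding_iff.2 hω))
  have h3 : n + 1 < M := by exact_mod_cast this
  exact (Nat.lt_succ_self n).trans h3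

theorem IsAttractor.mem_endpointOrbits_iff (hK : F.IsAttractor K)
    (hE : F.endpoints K ⊆ K) {y : ℝ} :
    y ∈ F.endpointOrbits K ↔ ∃ a ∈ F.endpoints K, ∃ n, F.OrbitReaches K n a y := by
  constructor
  · rintro ⟨a, ha, ω, hω, n, rfl⟩
    exact ⟨a, ha, n, by simpa [orbitPoint] using orbitReaches_orbitPoint (hK.isCoding_iff.1 hω) 0 n⟩
  · rintro ⟨a, ha, n, h⟩
    obtain ⟨ω, hω, rfl⟩ := hK.exists_coding_of_orbitReaches (hE ha) h
    exact ⟨a, ha, ω, hK.isCoding_iff.2 hω, n, rfl⟩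

/-! ### Endpoints of the first level pieces -/

theorem IsAttractor.convexHull_eq (hK : F.IsAttractor K) :
    convexHull ℝ K = Icc (sInf K) (sSup K) := by
  refine (convexHull_min (fun x hx => ?_) (convex_Icc _ _)).antisymm ?_
  · exact ⟨csInf_le hK.2.1.bddBelow hx, le_csSup hK.2.1.bddAbove hx⟩
  · exact (convex_convexHull ℝ K).ordConnected.out
      (subset_convexHull ℝ K (hK.2.1.sInf_mem hK.1)) (subset_convexHull ℝ K (hK.2.1.sSup_mem hK.1))

/-- The convex hull of a first level piece is the interval between two of its points, and is the
image of the convex hull of the attractor. -/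
theorem IsAttractor.exists_hull_eq_Icc (hK : F.IsAttractor K) (j : Fin m) :
    ∃ p q : ℝ, p ≤ q ∧ p ∈ F.map j '' K ∧ q ∈ F.map j '' K ∧
      F.map j '' convexHull ℝ K = Icc p q ∧ convexHull ℝ (F.map j '' K) = Icc p q := by
  have hle : sInf K ≤ sSup K := csInf_le_csSup hK.1 hK.2.1.bddBelow hK.2.1.bddAbove
  obtain ⟨p, q, hlen, hIcc, -, hends⟩ :=
    affine_image_Icc_Ioo (F.trans j) (F.ratio_ne_zero j) (sInf K) (sSup K)
  have himg : F.map j '' convexHull ℝ K = Icc p q := by rw [hK.convexHull_eq]; exact hIcc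
  have hpq : p ≤ q := by
    have := mul_nonneg (abs_nonneg (F.ratio j)) (sub_nonneg.2 hle)
    linarith
  have hmem : p ∈ F.map j '' K ∧ q ∈ F.map j '' K := by
    have h1 : F.map j (sInf K) ∈ F.map j '' K := mem_image_of_mem _ (hK.2.1.sInf_mem hK.1)
    have h2 : F.map j (sSup K) ∈ F.map j '' K := mem_image_of_mem _ (hK.2.1.sSup_mem hK.1)
    rcases hends with ⟨hp, hq⟩ | ⟨hp, hq⟩ <;> rw [hp, hq]
    exacts [⟨h1, h2⟩, ⟨h2, h1⟩]
  refine ⟨p, q, hpq, hmem.1, hmem.2, himg, ?_⟩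
  refine (convexHull_min ?_ (convex_Icc _ _)).antisymm ?_
  · rw [← himg]
    exact image_mono (subset_convexHull ℝ K)
  · exact (convex_convexHull ℝ _).ordConnected.out (subset_convexHull ℝ _ hmem.1)
      (subset_convexHull ℝ _ hmem.2)

theorem IsAttractor.endpoints_subset (hK : F.IsAttractor K) : F.endpoints K ⊆ K := by
  rintro a ⟨j, h⟩
  obtain ⟨p, q, hpq, hp, hq, -, hhull⟩ := hK.exists_hull_eq_Icc j
  rw [hhull] at h
  have hsub : F.map j '' K ⊆ K := image_subset_iff.2 fun x hx => hK.map_mem j hx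
  rcases h with h | h
  · rw [h.unique (isLeast_Icc hpq)]; exact hsub hp
  · rw [h.unique (isGreatest_Icc hpq)]; exact hsub hq

theorem IsAttractor.exists_endpoints (hK : F.IsAttractor K) (j : Fin m) :
    ∃ p ∈ F.endpoints K, ∃ q ∈ F.endpoints K, F.map j '' convexHull ℝ K = Icc p q := by
  obtain ⟨p, q, hpq, -, -, himg, hhull⟩ := hK.exists_hull_eq_Icc j
  exact ⟨p, ⟨j, Or.inl (hhull ▸ isLeast_Icc hpq)⟩, q, ⟨j, Or.inr (hhull ▸ isGreatest_Icc hpq)⟩,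
    himg⟩

theorem finite_endpoints (F : RealIFS m) (K : Set ℝ) : (F.endpoints K).Finite := by
  have : F.endpoints K = ⋃ j, ({a | IsLeast (convexHull ℝ (F.map j '' K)) a} ∪
      {a | IsGreatest (convexHull ℝ (F.map j '' K)) a}) := by
    ext a
    simp [endpoints]
  rw [this]
  refine finite_iUnion fun j => (Set.Subsingleton.finite ?_).union (Set.Subsingleton.finite ?_)
  · exact fun a ha b hb => ha.unique hb
  · exact fun a ha b hb => ha.unique hb

theorem IsAttractor.sInf_mem_endpoints (hK : F.IsAttractor K) : sInf K ∈ F.endpoints K := by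
  obtain ⟨j, y, hy, hyx⟩ := hK.exists_map_eq (hK.2.1.sInf_mem hK.1)
  obtain ⟨p, hp, q, hq, himg⟩ := hK.exists_endpoints j
  have hmem : sInf K ∈ Icc p q :=
    himg ▸ ⟨y, subset_convexHull ℝ K hy, hyx⟩
  rwa [le_antisymm (csInf_le hK.2.1.bddBelow (hK.endpoints_subset hp)) hmem.1]

theorem IsAttractor.sSup_mem_endpoints (hK : F.IsAttractor K) : sSup K ∈ F.endpoints K := by
  obtain ⟨j, y, hy, hyx⟩ := hK.exists_map_eq (hK.2.1.sSup_mem hK.1)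
  obtain ⟨p, hp, q, hq, himg⟩ := hK.exists_endpoints j
  have hmem : sSup K ∈ Icc p q :=
    himg ▸ ⟨y, subset_convexHull ℝ K hy, hyx⟩
  rwa [le_antisymm hmem.2 (le_csSup hK.2.1.bddAbove (hK.endpoints_subset hq))]

theorem IsAttractor.finite_endpointOrbits (hK : F.IsAttractor K)
    (hper : ∀ a ∈ F.endpoints K, F.IsPeriodicPt a) : (F.endpointOrbits K).Finite := by
  refine ((F.finite_endpoints K).biUnion fun a ha =>
    hK.finite_orbits (hK.endpoints_subset ha) (hper a ha)).subset fun y hy => ?_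
  obtain ⟨a, ha, h⟩ := (hK.mem_endpointOrbits_iff hK.endpoints_subset).1 hy
  exact mem_iUnion₂.2 ⟨a, ha, h⟩

theorem IsAttractor.endpoints_subset_endpointOrbits (hK : F.IsAttractor K) :
    F.endpoints K ⊆ F.endpointOrbits K := fun a ha =>
  (hK.mem_endpointOrbits_iff hK.endpoints_subset).2 ⟨a, ha, 0, rfl⟩

theorem IsAttractor.endpointOrbits_subset (hK : F.IsAttractor K) : F.endpointOrbits K ⊆ K := by
  rintro y ⟨a, -, ω, hω, n, rfl⟩
  exact hK.isCoding_iff.1 hω n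

theorem IsAttractor.mem_endpointOrbits_of_map_mem (hK : F.IsAttractor K) {i : Fin m} {z : ℝ}
    (hz : z ∈ K) (h : F.map i z ∈ F.endpointOrbits K) : z ∈ F.endpointOrbits K := by
  rw [hK.mem_endpointOrbits_iff hK.endpoints_subset] at h ⊢
  obtain ⟨a, ha, n, hn⟩ := h
  exact ⟨a, ha, n + 1, hn.trans (k := 1) ⟨i, z, hz, rfl, rfl⟩⟩

end Attractor

end RealIFS

/-! ### The blocks of the Markov partition -/

/-- A point outside a finite set `P`, with points of `P` on both sides, lies between two neighbours
of `P`. -/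
theorem Set.Finite.exists_consecutive {P : Set ℝ} (hP : P.Finite) {a b x : ℝ} (ha : a ∈ P)
    (hb : b ∈ P) (hax : a ≤ x) (hxb : x ≤ b) (hx : x ∉ P) :
    ∃ c d, P.Consecutive c d ∧ a ≤ c ∧ c < x ∧ x < d ∧ d ≤ b := by
  obtain ⟨c, ⟨hcP, hcx⟩, hc⟩ := exists_max_image (P ∩ Iic x) id (hP.subset inter_subset_left)
    ⟨a, ha, hax⟩
  obtain ⟨d, ⟨hdP, hxd⟩, hd⟩ := exists_min_image (P ∩ Ici x) id (hP.subset inter_subset_left)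
    ⟨b, hb, hxb⟩
  have hcx' : c < x := lt_of_le_of_ne hcx fun h => hx (h ▸ hcP)
  have hxd' : x < d := lt_of_le_of_ne hxd fun h => hx (h ▸ hdP)
  refine ⟨c, d, ⟨hcP, hdP, hcx'.trans hxd', ?_⟩, hc a ⟨ha, hax⟩, hcx', hxd', hd b ⟨hb, hxb⟩⟩
  rw [eq_empty_iff_forall_notMem]
  rintro y ⟨⟨hcy, hyd⟩, hyP⟩
  rcases le_total y x with h | h
  · exact absurd (hc y ⟨hyP, h⟩) (not_le.2 hcy)
  · exact absurd (hd y ⟨hyP, h⟩) (not_le.2 hyd)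

theorem Set.Consecutive.le_or_le {P : Set ℝ} {c d y : ℝ} (h : P.Consecutive c d) (hy : y ∈ P) :
    y ≤ c ∨ d ≤ y := by
  by_contra! hcon
  exact (h.2.2.2 ▸ ⟨hcon, hy⟩ : y ∈ (∅ : Set ℝ))

/-- Neighbouring pairs with a common point in between coincide. -/
theorem Set.Consecutive.eq_of_mem {P : Set ℝ} {c d c' d' z : ℝ} (h : P.Consecutive c d)
    (h' : P.Consecutive c' d') (hz : z ∈ Ioo c d) (hz' : z ∈ Ioo c' d') : c = c' ∧ d = d' := by
  have h1 := h.le_or_le h'.1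
  have h2 := h.le_or_le h'.2.1
  have h3 := h'.le_or_le h.1
  have h4 := h'.le_or_le h.2.1
  obtain ⟨z1, z2⟩ := hz
  obtain ⟨z3, z4⟩ := hz'
  constructor <;> apply le_antisymm
  · exact h3.resolve_right (by linarith)
  · exact h1.resolve_right (by linarith)
  · exact h2.resolve_left (by linarith)
  · exact h4.resolve_left (by linarith)

namespace RealIFS

variable {m : ℕ} {F : RealIFS m} {K : Set ℝ}

theorem finite_markovBlocks (hP : (F.endpointOrbits K).Finite) : (F.markovBlocks K).Finite :=
  (hP.prod hP).subset fun _ hp => ⟨hp.1.1, hp.1.2.1⟩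

/-- Between two points of the endpoint orbits the attractor is, up to closure, made of the open
blocks in between: the finitely many cut points are not isolated in it. -/
theorem IsAttractor.closure_Ioo_inter (hK : F.IsAttractor K) (hnt : K.Nontrivial)
    (hP : (F.endpointOrbits K).Finite) {p q : ℝ} (hp : p ∈ F.endpointOrbits K)
    (hq : q ∈ F.endpointOrbits K) :
    closure (Ioo p q ∩ K) = ⋃ (v : F.markovBlocks K) (_ : p ≤ v.1.1 ∧ v.1.2 ≤ q),
      closure (Ioo v.1.1 v.1.2 ∩ K) := by
  have := (finite_markovBlocks hP).to_subtype
  refine Subset.antisymm ?_ ?_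
  · have hclosed : IsClosed (⋃ (v : F.markovBlocks K) (_ : p ≤ v.1.1 ∧ v.1.2 ≤ q),
        closure (Ioo v.1.1 v.1.2 ∩ K)) :=
      isClosed_iUnion_of_finite fun v => isClosed_iUnion_of_finite fun _ => isClosed_closure
    refine closure_minimal ?_ hclosed
    refine (hK.subset_closure_diff_finite hnt hP isOpen_Ioo).trans (closure_minimal ?_ hclosed)
    rintro x ⟨⟨⟨hpx, hxq⟩, hxK⟩, hxP⟩
    obtain ⟨c, d, hcd, hpc, hcx, hxd, hdq⟩ := hP.exists_consecutive hp hq hpx.le hxq.le hxP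
    exact mem_iUnion₂.2 ⟨⟨(c, d), hcd, x, ⟨hcx, hxd⟩, hxK⟩, ⟨hpc, hdq⟩,
      subset_closure ⟨⟨hcx, hxd⟩, hxK⟩⟩
  · exact iUnion₂_subset fun v hv => closure_mono
      (inter_subset_inter_left _ (Ioo_subset_Ioo hv.1 hv.2))

theorem IsAttractor.eq_iUnion_closure (hK : F.IsAttractor K) (hnt : K.Nontrivial)
    (hP : (F.endpointOrbits K).Finite) :
    K = ⋃ v : F.markovBlocks K, closure (Ioo v.1.1 v.1.2 ∩ K) := by
  refine Subset.antisymm ?_ (iUnion_subset fun v =>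
    closure_minimal inter_subset_right hK.2.1.isClosed)
  have hinf := hK.endpoints_subset_endpointOrbits hK.sInf_mem_endpoints
  have hsup := hK.endpoints_subset_endpointOrbits hK.sSup_mem_endpoints
  have h1 : K ⊆ closure (Ioo (sInf K) (sSup K) ∩ K) := by
    intro y hy
    refine closure_mono ?_ (hK.subset_closure_diff_finite hnt hP isOpen_univ ⟨mem_univ y, hy⟩)
    rintro x ⟨⟨-, hxK⟩, hxP⟩
    refine ⟨⟨?_, ?_⟩, hxK⟩
    · exact lt_of_le_of_ne (csInf_le hK.2.1.bddBelow hxK) fun h => hxP (h ▸ hinf)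
    · exact lt_of_le_of_ne (le_csSup hK.2.1.bddAbove hxK) fun h => hxP (h ▸ hsup)
  refine h1.trans ?_
  rw [hK.closure_Ioo_inter hnt hP hinf hsup]
  exact iUnion_mono fun v => iUnion_subset fun _ => Subset.rfl

/-- On a block the lazy algorithm makes the choice it makes on the surrounding gap between first
level endpoints, so the block lies in the domain of the chosen expanding map. -/
theorem IsAttractor.block_subset_map_lazyIndex [NeZero m] (hK : F.IsAttractor K)
    (hlazy : F.LazyWellDefined K) {c d : ℝ} (hcd : (c, d) ∈ F.markovBlocks K) :
    Icc c d ∩ K ⊆ F.map (F.lazyIndex K c d) '' K := by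
  obtain ⟨hcons, z, ⟨hcz, hzd⟩, hzK⟩ := hcd
  simp only at hcons hcz hzd
  have hEP := hK.endpoints_subset_endpointOrbits
  have hzE : z ∉ F.endpoints K := fun h => by
    rcases hcons.le_or_le (hEP h) with h' | h' <;> linarith
  obtain ⟨a, a', haa, -, haz, hza, -⟩ := (F.finite_endpoints K).exists_consecutive
    hK.sInf_mem_endpoints hK.sSup_mem_endpoints (csInf_le hK.2.1.bddBelow hzK)
    (le_csSup hK.2.1.bddAbove hzK) hzE
  have hac : a ≤ c := (hcons.le_or_le (hEP haa.1)).resolve_right (by linarith)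
  have hda : d ≤ a' := (hcons.le_or_le (hEP haa.2.1)).resolve_left (by linarith)
  have hiff : ∀ k, F.HullContains K c d k ↔ F.HullContains K a a' k := by
    intro k
    obtain ⟨p, hp, q, hq, himg⟩ := hK.exists_endpoints k
    simp only [HullContains, himg, mem_Icc]
    constructor
    · rintro ⟨⟨h1, -⟩, -, h4⟩
      have hpa : p ≤ a := (haa.le_or_le hp).resolve_right (by linarith)
      have haq : a' ≤ q := (haa.le_or_le hq).resolve_left (by linarith)
      exact ⟨⟨hpa, by linarith⟩, by linarith, haq⟩
    · rintro ⟨⟨h1, h2⟩, h3, h4⟩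
      exact ⟨⟨by linarith, by linarith⟩, by linarith, by linarith⟩
  have hidx : F.lazyIndex K c d = F.lazyIndex K a a' := by
    unfold lazyIndex
    rw [funext fun k => propext (hiff k)]
  rw [hidx]
  refine (inter_subset_inter_left K (Icc_subset_Icc hac hda)).trans
    (hlazy a a' haa ?_ ⟨z, ⟨haz, hza⟩, hzK⟩)
  obtain ⟨k, y, hy, hyz⟩ := hK.exists_map_eq hzK
  obtain ⟨p, hp, q, hq, himg⟩ := hK.exists_endpoints k
  have hzpq : z ∈ Icc p q := himg ▸ ⟨y, subset_convexHull ℝ K hy, hyz⟩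
  have hpa : p ≤ a := (haa.le_or_le hp).resolve_right (by linarith [hzpq.1])
  have haq : a' ≤ q := (haa.le_or_le hq).resolve_left (by linarith [hzpq.2])
  refine ⟨k, ?_, ?_⟩ <;> rw [himg]
  · exact ⟨hpa, by linarith⟩
  · exact ⟨by linarith, haq⟩

/-- The Markov property: the lazy expanding map of a block carries it onto the part of the
attractor between two points of the endpoint orbits. -/
theorem IsAttractor.exists_expand_block [NeZero m] (hK : F.IsAttractor K)
    (hlazy : F.LazyWellDefined K) (u : F.markovBlocks K) :
    ∃ p ∈ F.endpointOrbits K, ∃ q ∈ F.endpointOrbits K,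
      F.map (F.lazyIndex K u.1.1 u.1.2) '' Ioo p q = Ioo u.1.1 u.1.2 ∧
      F.map (F.lazyIndex K u.1.1 u.1.2) '' (Ioo p q ∩ K) = Ioo u.1.1 u.1.2 ∩ K ∧
      F.expand (F.lazyIndex K u.1.1 u.1.2) '' (Icc u.1.1 u.1.2 ∩ K) = Icc p q ∩ K := by
  obtain ⟨⟨c, d⟩, hu⟩ := u
  have hsub := hK.block_subset_map_lazyIndex hlazy hu
  simp only
  set k := F.lazyIndex K c d
  have hcd : c < d := hu.1.2.2.1
  obtain ⟨c', hc'K, hc'⟩ := hsub ⟨left_mem_Icc.2 hcd.le, hK.endpointOrbits_subset hu.1.1⟩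
  obtain ⟨d', hd'K, hd'⟩ := hsub ⟨right_mem_Icc.2 hcd.le, hK.endpointOrbits_subset hu.1.2.1⟩
  have hc'P := hK.mem_endpointOrbits_of_map_mem hc'K (hc' ▸ hu.1.1 : F.map k c' ∈ _)
  have hd'P := hK.mem_endpointOrbits_of_map_mem hd'K (hd' ▸ hu.1.2.1 : F.map k d' ∈ _)
  obtain ⟨p, hp, q, hq, hIcc, hIoo⟩ : ∃ p ∈ F.endpointOrbits K, ∃ q ∈ F.endpointOrbits K,
      F.map k '' Icc p q = Icc c d ∧ F.map k '' Ioo p q = Ioo c d := by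
    have hr := abs_pos.2 (F.ratio_ne_zero k)
    rcases lt_trichotomy c' d' with h | h | h
    · obtain ⟨s, t, hlen, hIcc, hIoo, hends⟩ :=
        affine_image_Icc_Ioo (F.trans k) (F.ratio_ne_zero k) c' d'
      have hst := mul_pos hr (sub_pos.2 h)
      change F.map k '' _ = _ at hIcc hIoo
      change s = F.map k c' ∧ t = F.map k d' ∨ s = F.map k d' ∧ t = F.map k c' at hends
      rw [hc', hd'] at hends
      rcases hends with ⟨rfl, rfl⟩ | ⟨rfl, rfl⟩
      · exact ⟨c', hc'P, d', hd'P, hIcc, hIoo⟩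
      · linarith
    · rw [h, hd'] at hc'
      exact absurd hc' hcd.ne'
    · obtain ⟨s, t, hlen, hIcc, hIoo, hends⟩ :=
        affine_image_Icc_Ioo (F.trans k) (F.ratio_ne_zero k) d' c'
      have hst := mul_pos hr (sub_pos.2 h)
      change F.map k '' _ = _ at hIcc hIoo
      change s = F.map k d' ∧ t = F.map k c' ∨ s = F.map k c' ∧ t = F.map k d' at hends
      rw [hc', hd'] at hends
      rcases hends with ⟨rfl, rfl⟩ | ⟨rfl, rfl⟩
      · linarith
      · exact ⟨d', hd'P, c', hc'P, hIcc, hIoo⟩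
  refine ⟨p, hp, q, hq, hIoo, Subset.antisymm ?_ ?_, Subset.antisymm ?_ ?_⟩
  · rintro _ ⟨x, ⟨hx, hxK⟩, rfl⟩
    exact ⟨hIoo ▸ mem_image_of_mem _ hx, hK.map_mem k hxK⟩
  · rintro x ⟨hx, hxK⟩
    obtain ⟨y, hy, rfl⟩ := hsub ⟨Ioo_subset_Icc_self hx, hxK⟩
    rw [← hIoo, (F.map_injective k).mem_set_image] at hx
    exact mem_image_of_mem _ ⟨hx, hy⟩
  · rintro _ ⟨x, ⟨hx, hxK⟩, rfl⟩
    obtain ⟨y, hy, rfl⟩ := hsub ⟨hx, hxK⟩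
    rw [← hIcc, (F.map_injective k).mem_set_image] at hx
    simp only [expand_map]
    exact ⟨hx, hy⟩
  · rintro y ⟨hy, hyK⟩
    exact ⟨F.map k y, ⟨hIcc ▸ mem_image_of_mem _ hy, hK.map_mem k hyK⟩, F.expand_map k y⟩

/-- An edge of the Markov system joins a block to the blocks between the images of its ends. -/
theorem IsAttractor.markovSystem_adj_iff [NeZero m] (hK : F.IsAttractor K)
    {u v : F.markovBlocks K} {p q : ℝ}
    (h : F.expand (F.lazyIndex K u.1.1 u.1.2) '' (Icc u.1.1 u.1.2 ∩ K) = Icc p q ∩ K) :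
    (F.markovSystem K).Adj u v ↔ p ≤ v.1.1 ∧ v.1.2 ≤ q := by
  change Icc v.1.1 v.1.2 ∩ K ⊆ F.expand _ '' _ ↔ _
  rw [h]
  have hlt : v.1.1 < v.1.2 := v.2.1.2.2.1
  constructor
  · intro hsub
    exact ⟨(hsub ⟨left_mem_Icc.2 hlt.le, hK.endpointOrbits_subset v.2.1.1⟩).1.1,
      (hsub ⟨right_mem_Icc.2 hlt.le, hK.endpointOrbits_subset v.2.1.2.1⟩).1.2⟩
  · rintro ⟨hp, hq⟩
    exact inter_subset_inter_left K (Icc_subset_Icc hp hq)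

/-- The closures of the open blocks form an invariant vector of the Markov system. -/
theorem IsAttractor.isInvariant_closure [NeZero m] (hK : F.IsAttractor K) (hnt : K.Nontrivial)
    (hP : (F.endpointOrbits K).Finite) (hlazy : F.LazyWellDefined K) :
    (F.markovSystem K).IsInvariant fun u => closure (Ioo u.1.1 u.1.2 ∩ K) := by
  have hcpt : ∀ p q : ℝ, IsCompact (closure (Ioo p q ∩ K)) := fun p q =>
    hK.2.1.of_isClosed_subset isClosed_closure
      (closure_minimal inter_subset_right hK.2.1.isClosed)
  refine fun u => ⟨u.2.2.closure, hcpt _ _, ?_⟩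
  obtain ⟨p, hp, q, hq, -, himg, hexp⟩ := hK.exists_expand_block hlazy u
  simp only
  rw [← himg, ← image_closure_of_isCompact (hcpt p q) (F.continuous_map _).continuousOn,
    hK.closure_Ioo_inter hnt hP hp hq]
  simp only [image_iUnion]
  refine iUnion_congr fun v => iUnion_congr_Prop ?_ fun _ => rfl
  exact (hK.markovSystem_adj_iff hexp).symm

theorem IsAttractor.isGraphDirectedConstruction_markovSystem [NeZero m] (hK : F.IsAttractor K)
    (hnt : K.Nontrivial) (hP : (F.endpointOrbits K).Finite) (hlazy : F.LazyWellDefined K) :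
    (F.markovSystem K).IsGraphDirectedConstruction where
  finite_vertices := (finite_markovBlocks hP).to_subtype
  lo_lt_hi u := u.2.1.2.2.1
  disjoint_interiors u v huv := by
    rw [Set.disjoint_left]
    intro z hzu hzv
    obtain ⟨h1, h2⟩ := u.2.1.eq_of_mem v.2.1 hzu hzv
    exact huv (Subtype.ext (Prod.ext h1 h2))
  exists_edge u := by
    obtain ⟨hne, -, heq⟩ := hK.isInvariant_closure hnt hP hlazy u
    rw [heq] at hne
    obtain ⟨x, hx⟩ := hne
    obtain ⟨v, huv, -⟩ := mem_iUnion₂.1 hx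
    exact ⟨v, huv⟩
  ratio_ne_zero u _ _ := F.ratio_ne_zero _
  abs_ratio_lt_one u _ _ := F.abs_ratio_lt_one _
  open_set_subset u v huv := by
    obtain ⟨p, hp, q, hq, hIoo, -, hexp⟩ := hK.exists_expand_block hlazy u
    obtain ⟨h1, h2⟩ := (hK.markovSystem_adj_iff hexp).1 huv
    exact (image_mono (Ioo_subset_Ioo h1 h2)).trans hIoo.subset
  open_set_disjoint u v w _ _ hvw := by
    refine (disjoint_image_iff (F.map_injective (F.lazyIndex K u.1.1 u.1.2))).2 ?_
    rw [Set.disjoint_left]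
    intro z hzv hzw
    obtain ⟨h1, h2⟩ := v.2.1.eq_of_mem w.2.1 hzv hzw
    exact hvw (Subtype.ext (Prod.ext h1 h2))

end RealIFS

end

theorem theorem11 {m : ℕ} [NeZero m] (F : RealIFS m) (K : Set ℝ)
    (hK : F.IsAttractor K) (hKnontrivial : K.Nontrivial)
    (hoverlap : F.ExactlyOverlapping K)
    (hperiodic : ∀ a ∈ F.endpoints K, F.IsPeriodicPt a)
    (hlazy : F.LazyWellDefined K) :
    -- the endpoint orbits are finite, and cut `K` into blocks that form a Markov partition
    (F.endpointOrbits K).Finite ∧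
    K = (⋃ u ∈ F.markovBlocks K, Set.Icc u.1 u.2 ∩ K) ∧
    -- `K` is the graph-directed self-similar set of the system given by the blocks
    (F.markovSystem K).IsGraphDirectedSet K ∧
    (∀ C : F.markovBlocks K → Set ℝ, (F.markovSystem K).IsInvariant C →
      ∀ u, C u = closure (Set.Ioo u.1.1 u.1.2 ∩ K)) ∧
    -- the dimension of `K` is read off from the strongly connected components
    (∃ t : ℝ, IsGreatest {t : ℝ | 0 ≤ t ∧ ∃ D : Set (F.markovBlocks K),
        (F.markovSystem K).IsStrongComponent D ∧ (F.markovSystem K).PhiEqOne D t} t ∧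
      dimH K = ENNReal.ofReal t) ∧
    -- the strongly connected case
    ((F.markovSystem K).StronglyConnectedOn Set.univ →
      ∃ t : ℝ, 0 ≤ t ∧
        (∀ t' : ℝ, 0 ≤ t' → ((F.markovSystem K).PhiEqOne Set.univ t' ↔ t' = t)) ∧
        dimH K = ENNReal.ofReal t ∧
        0 < μH[t] K ∧ μH[t] K < ⊤) := by
  have hP := hK.finite_endpointOrbits hperiodic
  have hG := hK.isGraphDirectedConstruction_markovSystem hKnontrivial hP hlazy
  have hinv := hK.isInvariant_closure hKnontrivial hP hlazy
  have hfin := hG.finite_vertices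
  have hKU := hK.eq_iUnion_closure hKnontrivial hP
  have hCI : ∀ u : F.markovBlocks K,
      closure (Ioo u.1.1 u.1.2 ∩ K) ⊆ Icc u.1.1 u.1.2 ∩ K := fun u =>
    closure_minimal (inter_subset_inter_left K Ioo_subset_Icc_self)
      (isClosed_Icc.inter hK.2.1.isClosed)
  have huniq : ∀ C : F.markovBlocks K → Set ℝ, (F.markovSystem K).IsInvariant C →
      C = fun u => closure (Ioo u.1.1 u.1.2 ∩ K) := fun C hC => hC.eq hG hinv
  have hne : Nonempty (F.markovBlocks K) := by
    obtain ⟨x, hx⟩ := hK.1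
    rw [hKU] at hx
    exact ⟨(mem_iUnion.1 hx).choose⟩
  have := Fintype.ofFinite (F.markovBlocks K)
  obtain ⟨t, ht⟩ := GraphSystem.exists_isGreatest_phiEqOne hG
  have hdim := hG.dimH_eq hinv (fun u => (hCI u).trans inter_subset_left) ht
  rw [← hKU] at hdim
  refine ⟨hP, Subset.antisymm (fun x hx => ?_) (iUnion₂_subset fun _ _ => inter_subset_right),
    ⟨hG, ⟨_, hinv, huniq⟩, fun C hC => ?_⟩, fun C hC u => by rw [huniq C hC], ⟨t, ht, hdim⟩,
    fun hconn => ?_⟩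
  · rw [hKU] at hx
    obtain ⟨u, hu⟩ := mem_iUnion.1 hx
    exact mem_iUnion₂.2 ⟨u.1, u.2, hCI u hu⟩
  · rw [huniq C hC]
    exact hKU
  · obtain ⟨hiff, hpos, hlt⟩ := hG.hausdorffMeasure_of_stronglyConnected hinv
      (fun u => (hCI u).trans inter_subset_left) hconn ht
    rw [← hKU] at hpos hlt
    exact ⟨t, ht.1.1, hiff, hdim, hpos, hlt⟩
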